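/- Let $a,b,c$ be positive integers with $b\ge a+c-1$. Let $H(a,b,c)$ be the hexagon on the triangular lattice (with unit triangles as cells) whose angles are all $120^\circ$ and whose sides, counterclockwise starting from the horizontal bottom side, have lengths $b,a,c,b,a,c$. Let $H_{\mathrm a}(a,b,c)$ be the region obtained from $H(a,b,c)$ by removing the maximal staircases of lozenges from its top two corners. That is, at the northwestern corner, where the top side of length $b$ meets a side of length $a$, one removes $a-1,a-2,\dots,1$ lozenges in successive rows starting along the top side, all aligned at the side of length $a$ and having sides parallel to the two sides of the hexagon meeting at that corner. Likewise, at the northeastern corner, where the top side meets a side of length $c$, one removes $c-1,c-2,\dots,1$ lozenges in successive rows. Weight by $\tfrac12$ the $a$ tile positions that fit in the indentations of the northwestern zig-zag cut (these would form the next diagonal of the removed staircase) and the $c$ tile positions that fit in the indentations of the northeastern zig-zag cut. Let $$L^*_*(H_{\mathrm a}(a,b,c))=\sum_T 2^{-k(T)},$$ where $T$ runs over all lozenge tilings of $H_{\mathrm a}(a,b,c)$ and $k(T)$ is the number of lozenges of $T$ that occupy weighted positions. Then $$L^*_*(H_{\mathrm a}(a,b,c))=2^{-c-a}\,\frac{(b+2c-a+2)_a}{(a+b-c+2)_a}\prod_{j=1}^{a}\frac{(j-1)!\,(b+c-a+2j-1)!\,(b-a-c+2j+2)_j\,(b+2c-a+3j+2)_{a-j}}{(b+2j-1)!\,(c+a-j)!},$$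 where $(\alpha)_k=\alpha(\alpha+1)\cdots(\alpha+k-1)$ for $k\ge1$ and $(\alpha)_0=1$. -/

import Mathlib

namespace LozengeTiling

/-- The unit triangles of the triangular lattice. The lattice point `(x, y) : ℤ × ℤ` stands for the
point `x • e₁ + y • e₂` of the plane, where `e₁` is the horizontal unit vector pointing right and
`e₂` is the unit vector at an angle of 60 degrees (counterclockwise) with `e₁`.
* `up x y` is the triangle with vertices `(x, y)`, `(x + 1, y)`, `(x, y + 1)`;
* `down x y` is the triangle with vertices `(x + 1, y)`, `(x, y + 1)`, `(x + 1, y + 1)`. -/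
inductive Triangle where
  | up (x y : ℤ)
  | down (x y : ℤ)
  deriving DecidableEq

/-- The three vertices of a unit triangle. -/
def Triangle.vertices : Triangle → Finset (ℤ × ℤ)
  | .up x y => {(x, y), (x + 1, y), (x, y + 1)}
  | .down x y => {(x + 1, y), (x, y + 1), (x + 1, y + 1)}

/-- The lozenges, i.e. the unions of two unit triangles sharing an edge. A lozenge is determined by
the downward pointing triangle in it and by the side of this triangle (left, right or
top) along which it is joined to an upward pointing triangle. -/
inductive Lozenge where
  | left (x y : ℤ)
  | right (x y : ℤ)
  | top (x y : ℤ)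
  deriving DecidableEq

/-- The two unit triangles that make up a lozenge. -/
def Lozenge.cells : Lozenge → Finset Triangle
  | .left x y => {.down x y, .up x y}
  | .right x y => {.down x y, .up (x + 1) y}
  | .top x y => {.down x y, .up x (y + 1)}

/-- `T` is a lozenge tiling of the region `R` (a finite set of unit triangles): the lozenges
in `T` do not overlap, and together they cover exactly `R`. -/
def IsTiling (R : Finset Triangle) (T : Finset Lozenge) : Prop :=
  (∀ l ∈ T, ∀ l' ∈ T, l ≠ l' → Disjoint l.cells l'.cells) ∧ T.biUnion Lozenge.cells = R

instance (R : Finset Triangle) (T : Finset Lozenge) : Decidable (IsTiling R T) := by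
  unfold IsTiling; infer_instance

/-- The three lozenges containing a given downward pointing unit triangle. -/
def lozengesAt : Triangle → Finset Lozenge
  | .up _ _ => ∅
  | .down x y => {.left x y, .right x y, .top x y}

/-- The finite set of all lozenge tilings of `R`; see `mem_tilings`. -/
def tilings (R : Finset Triangle) : Finset (Finset Lozenge) :=
  {T ∈ (R.biUnion lozengesAt).powerset | IsTiling R T}

theorem mem_tilings {R : Finset Triangle} {T : Finset Lozenge} :
    T ∈ tilings R ↔ IsTiling R T := by
  simp only [tilings, Finset.mem_filter, Finset.mem_powerset, and_iff_right_iff_imp]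
  rintro ⟨-, rfl⟩ l hl
  simp only [Finset.mem_biUnion]
  cases l with
  | left x y => exact ⟨.down x y, ⟨_, hl, by simp [Lozenge.cells]⟩, by simp [lozengesAt]⟩
  | right x y => exact ⟨.down x y, ⟨_, hl, by simp [Lozenge.cells]⟩, by simp [lozengesAt]⟩
  | top x y => exact ⟨.down x y, ⟨_, hl, by simp [Lozenge.cells]⟩, by simp [lozengesAt]⟩

/-- The weighted count of the lozenge tilings of `R` in which the tile positions in `M` are weighted
by `1/2`: a tiling has weight `(1/2)^k`, where `k` is the number of its lozenges that occupy
positions in `M`. -/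
def weightedCount (R : Finset Triangle) (M : Finset Lozenge) : ℚ :=
  ∑ T ∈ tilings R, (1 / 2 : ℚ) ^ (T ∩ M).card

/-- The lattice points of the hexagon `H(a,b,c)` whose sides have lengths `b, a, c, b, a, c`,
counterclockwise from the bottom side. Its vertices are, in this order, `(0, 0)`, `(b, 0)`, `(b, a)`,
`(b - c, a + c)`, `(-c, a + c)`, `(-c, c)`. -/
def InHexagon (a b c : ℕ) (p : ℤ × ℤ) : Prop :=
  (0 ≤ p.2 ∧ p.2 ≤ a + c) ∧ (-c ≤ p.1 ∧ p.1 ≤ b) ∧ (0 ≤ p.1 + p.2 ∧ p.1 + p.2 ≤ a + b)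

instance (a b c : ℕ) (p : ℤ × ℤ) : Decidable (InHexagon a b c p) := by
  unfold InHexagon; infer_instance

/-- The hexagon `H(a,b,c)` as a finite set of unit triangles; see `mem_hexagon`. -/
noncomputable def hexagon (a b c : ℕ) : Finset Triangle :=
  {t ∈ (Finset.Icc (-c : ℤ) b ×ˢ Finset.Icc (0 : ℤ) (a + c)).biUnion
      (fun p => {.up p.1 p.2, .down p.1 p.2}) | ∀ v ∈ t.vertices, InHexagon a b c v}

theorem mem_hexagon {a b c : ℕ} {t : Triangle} :
    t ∈ hexagon a b c ↔ ∀ v ∈ t.vertices, InHexagon a b c v := by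
  simp only [hexagon, Finset.mem_filter, and_iff_right_iff_imp, Finset.mem_biUnion,
    Finset.mem_product, Finset.mem_Icc, Prod.exists]
  intro h
  cases t with
  | up x y =>
    have h1 := h (x, y) (by simp [Triangle.vertices])
    simp only [InHexagon] at h1
    exact ⟨x, y, by omega, by simp⟩
  | down x y =>
    have h1 := h (x + 1, y) (by simp [Triangle.vertices])
    have h2 := h (x, y + 1) (by simp [Triangle.vertices])
    simp only [InHexagon] at h1 h2
    exact ⟨x, y, by omega, by simp⟩

/-- The lozenges with sides parallel to the two sides of `H(a,b,c)` (of lengths `b` and `a`) that meet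
at the northwestern (top left) corner, indexed from this corner: `i` counts steps along the
side of length `a` (away from the top side), `j` counts steps along the top side. -/
def nwLozenge (a c i j : ℕ) : Lozenge := .left (-c + j) (a + c - 1 - i)

/-- The lozenges with sides parallel to the two sides of `H(a,b,c)` (of lengths `b` and `c`) that meet
at the northeastern (top right) corner, indexed from this corner: `i` counts steps along the
side of length `c` (away from the top side), `j` counts steps along the top side. -/
def neLozenge (a b c i j : ℕ) : Lozenge := .right (b - c - 1 - j + i) (a + c - 1 - i)

/-- The maximal staircase of lozenges at the northwestern corner, with rows of `a - 1, a - 2, …, 1`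
lozenges. -/
def nwStaircase (a c : ℕ) : Finset Lozenge :=
  {p ∈ Finset.range a ×ˢ Finset.range a | p.1 + p.2 + 1 < a}.image fun p => nwLozenge a c p.1 p.2

/-- The maximal staircase of lozenges at the northeastern corner, with rows of `c - 1, c - 2, …, 1`
lozenges. -/
def neStaircase (a b c : ℕ) : Finset Lozenge :=
  {p ∈ Finset.range c ×ˢ Finset.range c | p.1 + p.2 + 1 < c}.image fun p => neLozenge a b c p.1 p.2

/-- The `a` tile positions that fit in the indentations of the northwestern zig-zag cut, which
removes `nwStaircase`. -/
def nwCut (a c : ℕ) : Finset Lozenge :=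
  {p ∈ Finset.range a ×ˢ Finset.range a | p.1 + p.2 + 1 = a}.image fun p => nwLozenge a c p.1 p.2

/-- The `c` tile positions that fit in the indentations of the northeastern zig-zag cut, which
removes `neStaircase`. -/
def neCut (a b c : ℕ) : Finset Lozenge :=
  {p ∈ Finset.range c ×ˢ Finset.range c | p.1 + p.2 + 1 = c}.image fun p => neLozenge a b c p.1 p.2

/-- The region `H_a(a,b,c)`: the hexagon `H(a,b,c)` with the maximal staircases removed from its top
two corners. -/
noncomputable def regionHa (a b c : ℕ) : Finset Triangle :=
  hexagon a b c \ (nwStaircase a c ∪ neStaircase a b c).biUnion Lozenge.cells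

/-- The weighted count `L^*_*(H_a(a,b,c))`: the tile positions along both zig-zag cuts are weighted
by `1/2`. -/
noncomputable def bothWeightedCountHa (a b c : ℕ) : ℚ :=
  weightedCount (regionHa a b c) (nwCut a c ∪ neCut a b c)

/-- The shifted factorial `(α)_k = α (α + 1) ⋯ (α + k - 1)`. -/
def shiftedFactorial (α : ℚ) (k : ℕ) : ℚ := ∏ i ∈ Finset.range k, (α + i)

end LozengeTiling

open LozengeTiling
open scoped Nat

namespace LozengeTiling

/-! ### The Desnanot–Jacobi identity -/

/-! On a line with constant first coordinate `x`, call the unit edges that no lozenge crosses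
particles. From the line `x + 1` to the line `x` a particle stays or moves up by one, and no two
collide. So a tiling is a family of `a` nonintersecting lattice paths that start in the indentations
of the northwestern cut, where a horizontal first step has weight 1/2; continuing the paths
horizontally to the left keeps `a` particles on every line. The northeastern cut weights the holes
on the wall `x + 2y = b + 2a - 1`. Each of its `c` positions is a hole or a particle, so this
amounts to `(1/2)^c` times a weight 2 for each visit of a path to the wall. With that weight,
reflection gives a sum: the number of paths below the wall is the unrestricted number to the end
point plus that to its mirror image (`wallPaths_step`).

The weighted count is therefore a determinant of path numbers (`bothWeightedCountHa_eq_det`).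
Instead of a sign-reversing involution, the proof is an induction over the lines: peeling a strip
off the tilings (`weightedCount_remaining_succ`) and expanding the determinant row by row
(`det_pathMatrix_succ`) give the same recursion.

Column operations merge each entry with its mirror image into one path number (`det_wallPaths`). Up
to a linear factor per column, this leaves `catalanMatrix`, a three-parameter family that is closed
under the minors of Dodgson condensation. The product formula satisfies the same recurrence, whence
`det_catalanMatrix`. -/

theorem det_mul_det_adjugate_toBlocks₂₂ {p q R : Type*} [Fintype p] [DecidableEq p] [Fintype q]
    [DecidableEq q] [CommRing R] (M : Matrix (p ⊕ q) (p ⊕ q) R) :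
    M.det * M.adjugate.toBlocks₂₂.det = M.toBlocks₁₁.det * M.det ^ Fintype.card q := by
  -- Putting the second block column of the adjugate into the identity makes the product block
  -- triangular.
  have key : M * Matrix.fromBlocks 1 M.adjugate.toBlocks₁₂ 0 M.adjugate.toBlocks₂₂ =
      Matrix.fromBlocks M.toBlocks₁₁ 0 M.toBlocks₂₁ (M.det • 1) := by
    have h : M * M.adjugate = M.det • (1 : Matrix (p ⊕ q) (p ⊕ q) R) := M.mul_adjugate
    rw [← Matrix.fromBlocks_toBlocks M, ← Matrix.fromBlocks_toBlocks (Matrix.adjugate _),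
      Matrix.fromBlocks_multiply, ← Matrix.fromBlocks_one, Matrix.fromBlocks_smul,
      Matrix.fromBlocks_inj] at h
    conv_lhs => rw [← Matrix.fromBlocks_toBlocks M]
    rw [Matrix.fromBlocks_multiply]
    simp only [Matrix.fromBlocks_toBlocks, smul_zero] at h
    simp only [Matrix.mul_one, Matrix.mul_zero, add_zero, Matrix.fromBlocks_toBlocks]
    rw [h.2.1, h.2.2.2]
  have := congrArg Matrix.det key
  rw [Matrix.det_mul, Matrix.det_fromBlocks_zero₂₁, Matrix.det_fromBlocks_zero₁₂,
    Matrix.det_smul, Matrix.det_one, Matrix.det_one, one_mul, mul_one] at this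
  exact this

/-- The previous identity has one factor `M.det` too many. It can be cancelled for the matrix of
indeterminates over `ℤ`, and specialization reaches every commutative ring. -/
theorem det_adjugate_toBlocks₂₂ {p R : Type*} [Fintype p] [DecidableEq p] [CommRing R]
    (M : Matrix (p ⊕ Fin 2) (p ⊕ Fin 2) R) :
    M.adjugate.toBlocks₂₂.det = M.det * M.toBlocks₁₁.det := by
  let X := Matrix.mvPolynomialX (p ⊕ Fin 2) (p ⊕ Fin 2) ℤ
  have hX : X.adjugate.toBlocks₂₂.det = X.det * X.toBlocks₁₁.det := by
    apply mul_left_cancel₀ (Matrix.det_mvPolynomialX_ne_zero (p ⊕ Fin 2) ℤ)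
    rw [det_mul_det_adjugate_toBlocks₂₂, Fintype.card_fin]
    ring
  let f : MvPolynomial ((p ⊕ Fin 2) × (p ⊕ Fin 2)) ℤ →+* R :=
    (MvPolynomial.aeval fun ij : (p ⊕ Fin 2) × (p ⊕ Fin 2) => M ij.1 ij.2).toRingHom
  have hf : f.mapMatrix X = M := by
    ext i j
    simp [X, f, Matrix.mvPolynomialX]
  have := congrArg f hX
  rw [map_mul, RingHom.map_det, RingHom.map_det, RingHom.map_det, hf] at this
  have h1 : f.mapMatrix X.toBlocks₁₁ = M.toBlocks₁₁ := by rw [← hf]; rfl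
  have h2 : f.mapMatrix X.adjugate.toBlocks₂₂ = M.adjugate.toBlocks₂₂ := by
    rw [← hf, ← RingHom.map_adjugate]; rfl
  rwa [h1, h2] at this

/-- The middle indices of `Fin (m + 2)`, followed by the first and the last one. -/
def middleEnds (m : ℕ) : Fin m ⊕ Fin 2 → Fin (m + 2) :=
  Sum.elim (fun i => i.castSucc.succ) ![0, Fin.last (m + 1)]

theorem middleEnds_bijective (m : ℕ) : Function.Bijective (middleEnds m) := by
  rw [Fintype.bijective_iff_injective_and_card]
  refine ⟨?_, by simp⟩
  rintro (i | i) (j | j) h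
  · simpa [middleEnds, Fin.ext_iff] using h
  · fin_cases j <;> simp [middleEnds, Fin.ext_iff] at h
    omega
  · fin_cases i <;> simp [middleEnds, Fin.ext_iff] at h
    omega
  · fin_cases i <;> fin_cases j <;> simp [middleEnds, Fin.ext_iff] at h ⊢

/-- The Desnanot–Jacobi identity (Dodgson condensation). -/
theorem desnanot_jacobi {R : Type*} [CommRing R] (m : ℕ)
    (M : Matrix (Fin (m + 2)) (Fin (m + 2)) R) :
    M.det * (M.submatrix (fun i : Fin m => i.castSucc.succ) fun i : Fin m => i.castSucc.succ).det =
      (M.submatrix Fin.castSucc Fin.castSucc).det * (M.submatrix Fin.succ Fin.succ).det -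
      (M.submatrix Fin.succ Fin.castSucc).det * (M.submatrix Fin.castSucc Fin.succ).det := by
  let e : Fin m ⊕ Fin 2 ≃ Fin (m + 2) := Equiv.ofBijective _ (middleEnds_bijective m)
  have h := det_adjugate_toBlocks₂₂ (M.submatrix e e)
  rw [Matrix.det_submatrix_equiv_self, Matrix.adjugate_submatrix_equiv_self, Matrix.det_fin_two] at h
  have h11 : (M.submatrix e e).toBlocks₁₁ =
    M.submatrix (fun i : Fin m => i.castSucc.succ) fun i : Fin m => i.castSucc.succ := rfl
  have e0 : e (Sum.inr 0) = 0 := rfl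
  have e1 : e (Sum.inr 1) = Fin.last (m + 1) := rfl
  rw [h11] at h
  rw [← h]
  simp only [Matrix.toBlocks₂₂, Matrix.of_apply, Matrix.submatrix_apply, e0, e1,
    Matrix.adjugate_fin_succ_eq_det_submatrix]
  have s0 : (Fin.succAbove (0 : Fin (m + 2))) = Fin.succ := by ext; simp
  have s1 : (Fin.succAbove (Fin.last (m + 1))) = Fin.castSucc := by ext; simp
  rw [s0, s1]
  have hs : ((-1 : R) ^ (m + 1)) * (-1) ^ (m + 1) = 1 := by
    rw [← mul_pow]; simp
  have hs2 : ((-1 : R) ^ (m + 1 + (m + 1))) = 1 := by rw [pow_add, hs]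
  simp only [Fin.val_zero, Fin.val_last, add_zero, zero_add, pow_zero, one_mul, hs2]
  linear_combination (-(M.submatrix Fin.succ Fin.castSucc).det *
    (M.submatrix Fin.castSucc Fin.succ).det) * hs

/-! ### Binomial coefficients with integer lower index -/

/-- The binomial coefficient with integer lower index, which is `0` for negative lower index. -/
def zchoose (m : ℕ) (k : ℤ) : ℚ := if k < 0 then 0 else (m.choose k.toNat : ℚ)

theorem zchoose_of_neg {m : ℕ} {k : ℤ} (h : k < 0) : zchoose m k = 0 := if_pos h

theorem zchoose_natCast (m k : ℕ) : zchoose m k = (m.choose k : ℚ) := by simp [zchoose]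

theorem zchoose_of_lt {m : ℕ} {k : ℤ} (h : (m : ℤ) < k) : zchoose m k = 0 := by
  lift k to ℕ using by omega
  rw [zchoose_natCast, Nat.choose_eq_zero_of_lt (by omega), Nat.cast_zero]

theorem zchoose_succ (m : ℕ) (k : ℤ) : zchoose (m + 1) k = zchoose m (k - 1) + zchoose m k := by
  rcases lt_trichotomy k 0 with h | rfl | h
  · rw [zchoose_of_neg h, zchoose_of_neg h, zchoose_of_neg (by omega), add_zero]
  · simp [zchoose]
  · obtain ⟨n, rfl⟩ : ∃ n : ℕ, k = n + 1 := ⟨(k - 1).toNat, by omega⟩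
    have h1 : ((n : ℤ) + 1) = ((n + 1 : ℕ) : ℤ) := by push_cast; rfl
    rw [add_sub_cancel_right, h1, zchoose_natCast, zchoose_natCast, zchoose_natCast,
      Nat.choose_succ_succ]
    push_cast; rfl

theorem zchoose_zero (k : ℤ) : zchoose 0 k = if k = 0 then 1 else 0 := by
  rcases lt_trichotomy k 0 with h | rfl | h
  · rw [zchoose_of_neg h, if_neg h.ne]
  · simp [zchoose]
  · rw [zchoose_of_lt (by simpa using h), if_neg h.ne']

/-! ### A determinant of Mills–Robbins–Rumsey type -/

/-- The entries of the determinant evaluated in `det_catalanMatrix`. -/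
def catalanEntry (δ γ j i : ℕ) : ℚ :=
  zchoose (2 * γ + δ + j + 2 * i + 1) ((γ : ℤ) + i - j) / (2 * γ + δ + j + 2 * i + 1 : ℕ)

def catalanMatrix (n δ γ : ℕ) : Matrix (Fin n) (Fin n) ℚ :=
  Matrix.of fun j i => catalanEntry δ γ j i

/-- The entry depends on `i` and `γ` only through `γ + i`. -/
theorem catalanEntry_succ_right (δ γ j i : ℕ) :
    catalanEntry δ γ j (i + 1) = catalanEntry δ (γ + 1) j i := by
  unfold catalanEntry
  have h1 : 2 * γ + δ + j + 2 * (i + 1) + 1 = 2 * (γ + 1) + δ + j + 2 * i + 1 := by ring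
  rw [h1]; push_cast; congr 2; ring

/-- Lowering `j` and `γ` by 1 and raising `δ` by 3 preserves both `δ + 2γ + j` and `γ - j`. With the
column shift, this keeps the minors of the condensation in the family. -/
theorem catalanEntry_succ_left (δ γ j i : ℕ) :
    catalanEntry δ (γ + 1) (j + 1) i = catalanEntry (δ + 3) γ j i := by
  unfold catalanEntry
  have h1 : 2 * (γ + 1) + δ + (j + 1) + 2 * i + 1 = 2 * γ + (δ + 3) + j + 2 * i + 1 := by ring
  rw [h1]; push_cast; congr 2; ring

theorem catalanMatrix_submatrix_castSucc (n δ γ : ℕ) :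
    (catalanMatrix (n + 1) δ γ).submatrix Fin.castSucc Fin.castSucc = catalanMatrix n δ γ := rfl

theorem catalanMatrix_submatrix_castSucc_succ (n δ γ : ℕ) :
    (catalanMatrix (n + 1) δ γ).submatrix Fin.castSucc Fin.succ = catalanMatrix n δ (γ + 1) := by
  ext j i
  exact catalanEntry_succ_right δ γ j i

theorem catalanMatrix_submatrix_succ_castSucc (n δ γ : ℕ) :
    (catalanMatrix (n + 1) δ (γ + 1)).submatrix Fin.succ Fin.castSucc =
      catalanMatrix n (δ + 3) γ := by
  ext j i
  exact catalanEntry_succ_left δ γ j i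

theorem catalanMatrix_submatrix_succ (n δ γ : ℕ) :
    (catalanMatrix (n + 1) δ γ).submatrix Fin.succ Fin.succ = catalanMatrix n (δ + 3) γ := by
  ext j i
  exact (catalanEntry_succ_right δ γ (j + 1) i).trans (catalanEntry_succ_left δ γ j i)

theorem catalanMatrix_submatrix_middle (n δ γ : ℕ) :
    (catalanMatrix (n + 2) δ γ).submatrix (fun i : Fin n => i.castSucc.succ)
      (fun i : Fin n => i.castSucc.succ) = catalanMatrix n (δ + 3) γ := by
  rw [← catalanMatrix_submatrix_castSucc, ← catalanMatrix_submatrix_succ]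
  rfl

theorem catalanMatrix_condensation_succ (n δ γ : ℕ) :
    (catalanMatrix (n + 2) δ (γ + 1)).det * (catalanMatrix n (δ + 3) (γ + 1)).det =
      (catalanMatrix (n + 1) δ (γ + 1)).det * (catalanMatrix (n + 1) (δ + 3) (γ + 1)).det -
      (catalanMatrix (n + 1) (δ + 3) γ).det * (catalanMatrix (n + 1) δ (γ + 2)).det := by
  have h := desnanot_jacobi n (catalanMatrix (n + 2) δ (γ + 1))
  rwa [catalanMatrix_submatrix_middle, catalanMatrix_submatrix_castSucc,
    catalanMatrix_submatrix_succ, catalanMatrix_submatrix_succ_castSucc,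
    catalanMatrix_submatrix_castSucc_succ] at h

theorem catalanMatrix_condensation_zero (n δ : ℕ) :
    (catalanMatrix (n + 2) δ 0).det * (catalanMatrix n (δ + 3) 0).det =
      (catalanMatrix (n + 1) δ 0).det * (catalanMatrix (n + 1) (δ + 3) 0).det := by
  have h := desnanot_jacobi n (catalanMatrix (n + 2) δ 0)
  -- This is the minor that would need the parameter `γ - 1`; the lower indices in its last row are
  -- all negative.
  have h0 : ((catalanMatrix (n + 2) δ 0).submatrix Fin.succ Fin.castSucc).det = 0 := by
    apply Matrix.det_eq_zero_of_row_eq_zero (Fin.last n)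
    intro i
    simp only [catalanMatrix, Matrix.submatrix_apply, Matrix.of_apply, catalanEntry]
    rw [zchoose_of_neg, zero_div]
    simp only [Fin.val_succ, Fin.val_last, Fin.val_castSucc]
    push_cast
    have := i.2
    omega
  rwa [h0, zero_mul, sub_zero, catalanMatrix_submatrix_middle, catalanMatrix_submatrix_castSucc,
    catalanMatrix_submatrix_succ] at h

/-- The product `x! (x + d)! ⋯ (x + (n - 1) d)!`. -/
def factorialProd (d n x : ℕ) : ℚ := ∏ j ∈ Finset.range n, ((x + d * j)! : ℚ)

theorem factorialProd_pos (d n x : ℕ) : 0 < factorialProd d n x :=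
  Finset.prod_pos fun _ _ => by positivity

theorem factorialProd_succ (d n x : ℕ) :
    factorialProd d (n + 1) x = factorialProd d n x * (x + d * n)! := Finset.prod_range_succ _ _

theorem factorialProd_succ' (d n x : ℕ) :
    factorialProd d (n + 1) x = (x)! * factorialProd d n (x + d) := by
  unfold factorialProd
  rw [Finset.prod_range_succ', mul_comm]
  congr 1
  refine Finset.prod_congr rfl fun j _ => ?_
  rw [mul_add, mul_one, add_comm (d * j) d, add_assoc]

/-- The shifted factorials `(δ + 2l + 1)_l`, multiplied over `l < n`. -/
def risingProd (n : ℕ) (δ : ℚ) : ℚ := ∏ l ∈ Finset.range n, shiftedFactorial (δ + 2 * l + 1) l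

/-- The shifted factorials `(s + 3j + 1)_{n - 1 - j}`, multiplied over `j < n`. -/
def fallingProd (n : ℕ) (s : ℚ) : ℚ :=
  ∏ j ∈ Finset.range n, shiftedFactorial (s + 3 * j + 1) (n - 1 - j)

/-! ### Quotients of the product formula -/

theorem shiftedFactorial_succ (α : ℚ) (k : ℕ) :
    shiftedFactorial α (k + 1) = shiftedFactorial α k * (α + k) := Finset.prod_range_succ _ _

theorem shiftedFactorial_succ' (α : ℚ) (k : ℕ) :
    shiftedFactorial α (k + 1) = α * shiftedFactorial (α + 1) k := by
  unfold shiftedFactorial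
  rw [Finset.prod_range_succ', mul_comm]
  congr 1
  · simp
  · refine Finset.prod_congr rfl fun j _ => ?_
    push_cast; ring

theorem shiftedFactorial_pos {α : ℚ} (h : 0 < α) (k : ℕ) : 0 < shiftedFactorial α k :=
  Finset.prod_pos fun _ _ => by positivity

theorem risingProd_succ (n : ℕ) (δ : ℚ) :
    risingProd (n + 1) δ = risingProd n δ * shiftedFactorial (δ + 2 * n + 1) n :=
  Finset.prod_range_succ _ _

theorem fallingProd_succ' (n : ℕ) (s : ℚ) :
    fallingProd (n + 1) s = shiftedFactorial (s + 1) n * fallingProd n (s + 3) := by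
  unfold fallingProd
  rw [Finset.prod_range_succ', mul_comm]
  congr 1
  · simp
  · refine Finset.prod_congr rfl fun j _ => ?_
    rw [show n + 1 - 1 - (j + 1) = n - 1 - j by omega]
    congr 1
    push_cast; ring

theorem risingProd_pos (n : ℕ) {δ : ℚ} (h : 0 ≤ δ) : 0 < risingProd n δ :=
  Finset.prod_pos fun _ _ => shiftedFactorial_pos (by positivity) _

theorem fallingProd_pos (n : ℕ) {s : ℚ} (h : 0 ≤ s) : 0 < fallingProd n s :=
  Finset.prod_pos fun _ _ => shiftedFactorial_pos (by positivity) _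

/-- The value of the determinant of `catalanMatrix n δ γ`. -/
def catalanValue (n δ γ : ℕ) : ℚ :=
  factorialProd 1 n 0 * factorialProd 2 n (δ + 2 * γ) * risingProd n δ *
    fallingProd n (δ + 3 * γ + 1) / (factorialProd 2 n (δ + n + γ) * factorialProd 1 n γ)

/-- Positivity allows division by the middle minor in the condensation. -/
theorem catalanValue_pos (n δ γ : ℕ) : 0 < catalanValue n δ γ := by
  have h1 := risingProd_pos n (δ := (δ : ℚ)) (by positivity)
  have h2 := fallingProd_pos n (s := (δ : ℚ) + 3 * γ + 1) (by positivity)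
  have := factorialProd_pos 1 n 0
  have := factorialProd_pos 2 n (δ + 2 * γ)
  have := factorialProd_pos 2 n (δ + n + γ)
  have := factorialProd_pos 1 n γ
  unfold catalanValue
  positivity

/-- The shift of `δ` by 3 aligns the last shifted factorials on both sides, and a single linear
factor survives. -/
theorem risingProd_ratio (n : ℕ) (δ : ℚ) :
    risingProd (n + 2) δ * risingProd n (δ + 3) =
      risingProd (n + 1) δ * risingProd (n + 1) (δ + 3) * (δ + 2 * n + 3) := by
  rw [risingProd_succ (n + 1), risingProd_succ n (δ + 3), shiftedFactorial_succ']
  push_cast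
  rw [show δ + 2 * ((n : ℚ) + 1) + 1 + 1 = δ + 3 + 2 * n + 1 by ring]
  ring

theorem fallingProd_ratio (n : ℕ) (s : ℚ) :
    fallingProd (n + 2) s * fallingProd n (s + 3) =
      fallingProd (n + 1) s * fallingProd (n + 1) (s + 3) * (s + n + 1) := by
  rw [fallingProd_succ' (n + 1), fallingProd_succ' n s, shiftedFactorial_succ]
  ring

/-- The quotient `R(n+1,δ,γ) R(n+1,δ+3,γ) / (R(n+2,δ,γ) R(n,δ+3,γ))` for `R = catalanValue`. -/
theorem catalanValue_ratio (n δ γ : ℕ) :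
    catalanValue (n + 1) δ γ * catalanValue (n + 1) (δ + 3) γ *
        ((n + 1) * (δ + 2 * n + 3) * (δ + 3 * γ + n + 2)) =
      catalanValue (n + 2) δ γ * catalanValue n (δ + 3) γ *
        ((δ + 2 * γ + 2 * n + 3) * (δ + γ + n + 2) * (γ + n + 1)) := by
  have hS : factorialProd 1 (n + 2) 0 * factorialProd 1 n 0 =
      factorialProd 1 (n + 1) 0 * factorialProd 1 (n + 1) 0 * (n + 1) := by
    rw [factorialProd_succ 1 (n + 1), factorialProd_succ 1 n]
    simp only [zero_add, one_mul, Nat.factorial_succ n]; push_cast; ring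
  have hU : factorialProd 2 (n + 2) (δ + 2 * γ) * factorialProd 2 n (δ + 3 + 2 * γ) *
      (δ + 2 * γ + 2 * n + 3) =
      factorialProd 2 (n + 1) (δ + 2 * γ) * factorialProd 2 (n + 1) (δ + 3 + 2 * γ) := by
    rw [factorialProd_succ 2 (n + 1), factorialProd_succ 2 n (δ + 3 + 2 * γ),
      show δ + 3 + 2 * γ + 2 * n = (δ + 2 * γ + 2 * (n + 1)) + 1 by ring, Nat.factorial_succ]
    push_cast; ring
  have hV : factorialProd 2 (n + 2) (δ + (n + 2) + γ) * factorialProd 2 n (δ + 3 + n + γ) =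
      factorialProd 2 (n + 1) (δ + (n + 1) + γ) * factorialProd 2 (n + 1) (δ + 3 + (n + 1) + γ) *
        (δ + γ + n + 2) := by
    rw [factorialProd_succ' 2 (n + 1), factorialProd_succ' 2 n (δ + (n + 1) + γ),
      show δ + (n + 2) + γ + 2 = δ + 3 + (n + 1) + γ by ring,
      show δ + (n + 1) + γ + 2 = δ + 3 + n + γ by ring,
      show δ + (n + 2) + γ = (δ + (n + 1) + γ) + 1 by ring, Nat.factorial_succ]
    push_cast; ring
  have hW : factorialProd 1 (n + 2) γ * factorialProd 1 n γ =
      factorialProd 1 (n + 1) γ * factorialProd 1 (n + 1) γ * (γ + n + 1) := by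
    rw [factorialProd_succ 1 (n + 1), factorialProd_succ 1 n γ,
      show γ + 1 * (n + 1) = (γ + 1 * n) + 1 by ring, Nat.factorial_succ]
    push_cast; ring
  have hP := risingProd_ratio n (δ : ℚ)
  have hQ := fallingProd_ratio n ((δ : ℚ) + 3 * γ + 1)
  have hV1 := factorialProd_pos 2 (n + 2) (δ + (n + 2) + γ)
  have hV2 := factorialProd_pos 2 n (δ + 3 + n + γ)
  have hV3 := factorialProd_pos 2 (n + 1) (δ + (n + 1) + γ)
  have hV4 := factorialProd_pos 2 (n + 1) (δ + 3 + (n + 1) + γ)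
  have hW1 := factorialProd_pos 1 (n + 2) γ
  have hW2 := factorialProd_pos 1 n γ
  have hW3 := factorialProd_pos 1 (n + 1) γ
  unfold catalanValue
  push_cast
  rw [show (δ : ℚ) + 3 + 3 * γ + 1 = δ + 3 * γ + 1 + 3 by ring]
  rw [div_mul_div_comm, div_mul_div_comm, div_mul_eq_mul_div, div_mul_eq_mul_div,
    div_eq_div_iff (by positivity) (by positivity)]
  -- With the products opaque, the claim is a formal consequence of the six quotient identities
  -- above.
  generalize factorialProd 1 (n + 2) 0 = S1 at *
  generalize factorialProd 1 (n + 1) 0 = S2 at *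
  generalize factorialProd 1 n 0 = S3 at *
  generalize factorialProd 2 (n + 2) (δ + 2 * γ) = U1 at *
  generalize factorialProd 2 n (δ + 3 + 2 * γ) = U2 at *
  generalize factorialProd 2 (n + 1) (δ + 2 * γ) = U3 at *
  generalize factorialProd 2 (n + 1) (δ + 3 + 2 * γ) = U4 at *
  generalize factorialProd 2 (n + 2) (δ + (n + 2) + γ) = V1 at *
  generalize factorialProd 2 n (δ + 3 + n + γ) = V2 at *
  generalize factorialProd 2 (n + 1) (δ + (n + 1) + γ) = V3 at *
  generalize factorialProd 2 (n + 1) (δ + 3 + (n + 1) + γ) = V4 at *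
  generalize factorialProd 1 (n + 2) γ = W1 at *
  generalize factorialProd 1 n γ = W2 at *
  generalize factorialProd 1 (n + 1) γ = W3 at *
  generalize risingProd (n + 2) (δ : ℚ) = P1 at *
  generalize risingProd n ((δ : ℚ) + 3) = P2 at *
  generalize risingProd (n + 1) (δ : ℚ) = P3 at *
  generalize risingProd (n + 1) ((δ : ℚ) + 3) = P4 at *
  generalize fallingProd (n + 2) ((δ : ℚ) + 3 * γ + 1) = Q1 at *
  generalize fallingProd n ((δ : ℚ) + 3 * γ + 1 + 3) = Q2 at *
  generalize fallingProd (n + 1) ((δ : ℚ) + 3 * γ + 1) = Q3 at *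
  generalize fallingProd (n + 1) ((δ : ℚ) + 3 * γ + 1 + 3) = Q4 at *
  calc _ = (U3 * U4) * (S2 * S2 * (n + 1)) * (P3 * P4 * (δ + 2 * n + 3)) *
        (Q3 * Q4 * (δ + 3 * γ + 1 + n + 1)) * (V1 * V2) * (W1 * W2) := by ring
    _ = _ := by rw [← hU, ← hS, ← hP, ← hQ, hV, hW]; ring

/-- The quotient `R(n+1,δ+3,γ) R(n+1,δ,γ+2) / (R(n+1,δ,γ+1) R(n+1,δ+3,γ+1))` for
`R = catalanValue`. -/
theorem catalanValue_ratio' (n δ γ : ℕ) :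
    catalanValue (n + 1) (δ + 3) γ * catalanValue (n + 1) δ (γ + 2) *
        ((δ + 2 * γ + 2 * n + 5) * (δ + γ + n + 3) * (γ + n + 2)) =
      catalanValue (n + 1) δ (γ + 1) * catalanValue (n + 1) (δ + 3) (γ + 1) *
        ((δ + 2 * γ + 3) * (δ + γ + 3 * n + 5) * (γ + 1)) := by
  have hU : factorialProd 2 (n + 1) (δ + 3 + 2 * γ) * factorialProd 2 (n + 1) (δ + 2 * (γ + 2)) *
      (δ + 2 * γ + 2 * n + 5) =
      factorialProd 2 (n + 1) (δ + 2 * (γ + 1)) * factorialProd 2 (n + 1) (δ + 3 + 2 * (γ + 1)) *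
        (δ + 2 * γ + 3) := by
    rw [factorialProd_succ' 2 n (δ + 3 + 2 * γ), factorialProd_succ 2 n (δ + 2 * (γ + 2)),
      factorialProd_succ' 2 n (δ + 2 * (γ + 1)), factorialProd_succ 2 n (δ + 3 + 2 * (γ + 1)),
      show δ + 2 * (γ + 1) + 2 = δ + 2 * (γ + 2) by ring,
      show δ + 3 + 2 * γ + 2 = δ + 3 + 2 * (γ + 1) by ring,
      show δ + 3 + 2 * (γ + 1) + 2 * n = δ + 2 * (γ + 2) + 2 * n + 1 by ring,
      show δ + 3 + 2 * γ = δ + 2 * (γ + 1) + 1 by ring, Nat.factorial_succ, Nat.factorial_succ]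
    push_cast; ring
  have hV : factorialProd 2 (n + 1) (δ + (n + 1) + (γ + 1)) *
      factorialProd 2 (n + 1) (δ + 3 + (n + 1) + (γ + 1)) * (δ + γ + n + 3) =
      factorialProd 2 (n + 1) (δ + 3 + (n + 1) + γ) *
        factorialProd 2 (n + 1) (δ + (n + 1) + (γ + 2)) * (δ + γ + 3 * n + 5) := by
    rw [factorialProd_succ' 2 n (δ + (n + 1) + (γ + 1)),
      factorialProd_succ 2 n (δ + 3 + (n + 1) + (γ + 1)),
      factorialProd_succ 2 n (δ + 3 + (n + 1) + γ),
      factorialProd_succ' 2 n (δ + (n + 1) + (γ + 2)),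
      show δ + (n + 1) + (γ + 1) + 2 = δ + 3 + (n + 1) + γ by ring,
      show δ + (n + 1) + (γ + 2) + 2 = δ + 3 + (n + 1) + (γ + 1) by ring,
      show δ + 3 + (n + 1) + (γ + 1) + 2 * n = δ + 3 + (n + 1) + γ + 2 * n + 1 by ring,
      show δ + (n + 1) + (γ + 2) = δ + (n + 1) + (γ + 1) + 1 by ring,
      Nat.factorial_succ, Nat.factorial_succ]
    push_cast; ring
  have hW : factorialProd 1 (n + 1) (γ + 1) * factorialProd 1 (n + 1) (γ + 1) * (γ + n + 2) =
      factorialProd 1 (n + 1) γ * factorialProd 1 (n + 1) (γ + 2) * (γ + 1) := by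
    nth_rewrite 2 [factorialProd_succ' 1 n (γ + 1)]
    rw [factorialProd_succ 1 n (γ + 1), factorialProd_succ' 1 n γ,
      factorialProd_succ 1 n (γ + 2), show γ + 2 + 1 * n = γ + 1 + 1 * n + 1 by ring,
      Nat.factorial_succ (γ + 1 + 1 * n), Nat.factorial_succ γ]
    push_cast; ring
  have hV1 := factorialProd_pos 2 (n + 1) (δ + (n + 1) + (γ + 1))
  have hV2 := factorialProd_pos 2 (n + 1) (δ + 3 + (n + 1) + (γ + 1))
  have hV3 := factorialProd_pos 2 (n + 1) (δ + 3 + (n + 1) + γ)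
  have hV4 := factorialProd_pos 2 (n + 1) (δ + (n + 1) + (γ + 2))
  have hW1 := factorialProd_pos 1 (n + 1) (γ + 1)
  have hW2 := factorialProd_pos 1 (n + 1) γ
  have hW3 := factorialProd_pos 1 (n + 1) (γ + 2)
  unfold catalanValue
  push_cast
  rw [show (δ : ℚ) + 3 + 3 * γ + 1 = δ + 3 * (γ + 1) + 1 by ring,
    show (δ : ℚ) + 3 * (γ + 2) + 1 = δ + 3 + 3 * (γ + 1) + 1 by ring]
  rw [div_mul_div_comm, div_mul_div_comm, div_mul_eq_mul_div, div_mul_eq_mul_div,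
    div_eq_div_iff (by positivity) (by positivity)]
  generalize factorialProd 1 (n + 1) 0 = S1 at *
  generalize factorialProd 2 (n + 1) (δ + 3 + 2 * γ) = U1 at *
  generalize factorialProd 2 (n + 1) (δ + 2 * (γ + 2)) = U2 at *
  generalize factorialProd 2 (n + 1) (δ + 2 * (γ + 1)) = U3 at *
  generalize factorialProd 2 (n + 1) (δ + 3 + 2 * (γ + 1)) = U4 at *
  generalize factorialProd 2 (n + 1) (δ + (n + 1) + (γ + 1)) = V1 at *
  generalize factorialProd 2 (n + 1) (δ + 3 + (n + 1) + (γ + 1)) = V2 at *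
  generalize factorialProd 2 (n + 1) (δ + 3 + (n + 1) + γ) = V3 at *
  generalize factorialProd 2 (n + 1) (δ + (n + 1) + (γ + 2)) = V4 at *
  generalize factorialProd 1 (n + 1) (γ + 1) = W1 at *
  generalize factorialProd 1 (n + 1) γ = W2 at *
  generalize factorialProd 1 (n + 1) (γ + 2) = W3 at *
  generalize risingProd (n + 1) (δ : ℚ) = P1 at *
  generalize risingProd (n + 1) ((δ : ℚ) + 3) = P2 at *
  generalize fallingProd (n + 1) ((δ : ℚ) + 3 * (γ + 1) + 1) = Q1 at *
  generalize fallingProd (n + 1) ((δ : ℚ) + 3 + 3 * (γ + 1) + 1) = Q2 at *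
  calc _ = (U1 * U2 * (δ + 2 * γ + 2 * n + 5)) * (V1 * V2 * (δ + γ + n + 3)) *
        (W1 * W1 * (γ + n + 2)) * (S1 * S1 * P1 * P2 * Q1 * Q2) := by ring
    _ = _ := by rw [hU, hV, hW]; ring

theorem det_catalanMatrix (n δ γ : ℕ) : (catalanMatrix n δ γ).det = catalanValue n δ γ := by
  induction n using Nat.strong_induction_on generalizing δ γ with
  | _ n ih =>
  match n, ih with
  | 0, _ => simp [catalanValue, factorialProd, risingProd, fallingProd]
  | 1, _ =>
    rw [Matrix.det_fin_one]
    simp only [catalanMatrix, catalanEntry, Matrix.of_apply, catalanValue, factorialProd,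
      risingProd, fallingProd, shiftedFactorial]
    simp only [Fin.val_zero, Nat.cast_zero, add_zero, mul_zero, sub_zero, zchoose_natCast,
      Finset.range_one, Finset.prod_singleton, Nat.factorial_zero, Finset.range_zero,
      Finset.prod_empty, mul_one, one_mul, tsub_self, Nat.cast_one]
    rw [Nat.cast_choose ℚ (by omega : γ ≤ 2 * γ + δ + 1), Nat.factorial_succ,
      show 2 * γ + δ + 1 - γ = δ + 1 + γ by omega, add_comm (2 * γ) δ]
    push_cast
    field_simp
  | n + 2, ih =>
    have hpos := catalanValue_pos n (δ + 3) γ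
    refine mul_right_cancel₀ hpos.ne' ?_
    have hr := catalanValue_ratio n δ γ
    have hne : ((n : ℚ) + 1) * (δ + 2 * n + 3) * (δ + 3 * γ + n + 2) ≠ 0 := by positivity
    cases γ with
    | zero =>
      have h := catalanMatrix_condensation_zero n δ
      rw [ih n (by omega), ih (n + 1) (by omega), ih (n + 1) (by omega)] at h
      rw [h]
      refine mul_right_cancel₀ hne ?_
      rw [hr]; push_cast; ring
    | succ γ =>
      have h := catalanMatrix_condensation_succ n δ γ
      rw [ih n (by omega), ih (n + 1) (by omega), ih (n + 1) (by omega), ih (n + 1) (by omega),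
        ih (n + 1) (by omega)] at h
      rw [h]
      have hr' := catalanValue_ratio' n δ γ
      refine mul_right_cancel₀ hne ?_
      have hne' : ((δ : ℚ) + 2 * γ + 2 * n + 5) * (δ + γ + n + 3) * (γ + n + 2) ≠ 0 := by positivity
      refine mul_right_cancel₀ hne' ?_
      push_cast at hr ⊢
      -- Behind this is the polynomial identity `(δ+2γ+2n+5)(δ+γ+n+3)(γ+n+2) -
      -- (δ+2γ+3)(δ+γ+3n+5)(γ+1) = (n+1)(δ+2n+3)(δ+3γ+n+5)`.
      linear_combination
        ((n : ℚ) + 1) * (δ + 2 * n + 3) * (δ + 3 * (γ + 1) + n + 2) * (hr - hr')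

/-! ### Counting lattice paths whose first step is weighted -/

/-- The number of lattice paths with `p` down steps among `m + 1` steps, where the paths which do not
start with a down step are counted with weight `1/2`. -/
def halfStart (m : ℕ) (p : ℤ) : ℚ := zchoose m (p - 1) + 1 / 2 * zchoose m p

theorem halfStart_succ (m : ℕ) (p : ℤ) :
    halfStart (m + 1) p = halfStart m (p - 1) + halfStart m p := by
  unfold halfStart
  rw [zchoose_succ, zchoose_succ]
  ring

theorem halfStart_of_neg {m : ℕ} {p : ℤ} (h : p < 0) : halfStart m p = 0 := by
  unfold halfStart
  rw [zchoose_of_neg h, zchoose_of_neg (by omega)]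
  ring

theorem halfStart_of_lt {m : ℕ} {p : ℤ} (h : (m : ℤ) + 1 < p) : halfStart m p = 0 := by
  unfold halfStart
  rw [zchoose_of_lt (by omega), zchoose_of_lt (by omega)]
  ring

theorem halfStart_zero (p : ℤ) :
    halfStart 0 p = if p = 1 then 1 else if p = 0 then 1 / 2 else 0 := by
  unfold halfStart
  rw [zchoose_zero, zchoose_zero]
  split_ifs <;> first | omega | norm_num

/-- Vandermonde's convolution, which only needs Pascal's rule `halfStart_succ`. -/
theorem halfStart_add (m n : ℕ) (q : ℤ) :
    halfStart (m + n) q = ∑ l ∈ Finset.range (n + 1), (n.choose l : ℚ) * halfStart m (q - l) := by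
  induction n generalizing q with
  | zero => simp
  | succ n ih =>
    rw [← add_assoc, halfStart_succ, ih, ih, Finset.sum_range_succ' _ (n + 1)]
    simp only [Nat.choose_succ_succ, Nat.cast_add, add_mul, Finset.sum_add_distrib]
    rw [add_assoc]
    congr 1
    · refine Finset.sum_congr rfl fun l _ => ?_
      push_cast
      rw [show q - 1 - (l : ℤ) = q - (l + 1) by ring]
    · rw [Finset.sum_range_succ', Finset.sum_range_succ (fun l => (n.choose (l + 1) : ℚ) * _) n]
      simp

/-- With `N + 1` steps, `p` of them down, the two binomials combine to `(N+1+p) / (2(N+1))` times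
`(N+1).choose p`. Here `N + 1 + p` is free of `j`, so it can be pulled out of the column `i`. -/
theorem halfStart_eq (δ γ j i : ℕ) :
    halfStart (2 * γ + δ + j + 2 * i) ((γ : ℤ) + i - j) =
      1 / 2 * ((δ : ℚ) + 3 * γ + 1 + 3 * i) * catalanEntry δ γ j i := by
  unfold catalanEntry halfStart
  rcases lt_or_ge ((γ : ℤ) + i - j) 0 with h | h
  · rw [zchoose_of_neg h, zchoose_of_neg h, zchoose_of_neg (by omega)]
    simp
  · obtain ⟨p, hp⟩ : ∃ p : ℕ, (γ : ℤ) + i - j = p := ⟨_, (Int.toNat_of_nonneg h).symm⟩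
    rw [hp]
    obtain ⟨N, hN⟩ : ∃ N, N = 2 * γ + δ + j + 2 * i := ⟨_, rfl⟩
    rw [← hN]
    have hs : (δ : ℚ) + 3 * γ + 1 + 3 * i = N + 1 + p := by
      have : (δ : ℤ) + 3 * γ + 1 + 3 * i = N + 1 + p := by rw [← hp, hN]; push_cast; ring
      exact_mod_cast this
    rw [hs]
    have h1 : zchoose (N + 1) (p : ℤ) = zchoose N ((p : ℤ) - 1) + zchoose N p := zchoose_succ _ _
    have h2 : zchoose N ((p : ℤ) - 1) * (N + 1) = zchoose (N + 1) (p : ℤ) * p := by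
      cases p with
      | zero => simp [zchoose_of_neg]
      | succ p =>
        rw [show ((p + 1 : ℕ) : ℤ) - 1 = p by push_cast; ring, zchoose_natCast, zchoose_natCast]
        have := Nat.add_one_mul_choose_eq N p
        rw [mul_comm]
        exact_mod_cast this
    have h3 : ((N + 1 : ℕ) : ℚ) ≠ 0 := by positivity
    push_cast at h3 ⊢
    field_simp
    linear_combination (-(N : ℚ) - 1) * h1 + h2

/-- The weighted number of lattice paths from the `j`-th start point `(-c + j, c + j)` to `(x, y)`,
with steps `(1, 0)` and `(1, -1)`, below the wall `x + 2 y = K`, where each visit of the wall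
has weight `2` and a first step `(1, 0)` has weight `1/2`. Left of its start point a path is
continued by horizontal steps. -/
def wallPaths (c : ℕ) (K : ℤ) (j : ℕ) (x y : ℤ) : ℚ :=
  if x + c ≤ j then (if y = c + j then 1 else 0)
  else halfStart (x + c - j - 1).toNat (c + j - y) +
    halfStart (x + c - j - 1).toNat (c + j - (K - x - y))

/-- The positions for the particles (the lattice edges which are parallel to the side of length `a`
and are not crossed by lozenges) on the line with first coordinate `x`. -/
def IsSite (a b c : ℕ) (x y : ℤ) : Prop :=
  0 ≤ y ∧ 0 ≤ x + y ∧ y + 1 ≤ a + c ∧ x + 2 * y + 1 ≤ b + 2 * a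

instance (a b c : ℕ) (x y : ℤ) : Decidable (IsSite a b c x y) := by
  unfold IsSite; infer_instance

/-- The weight of a particle that stays at `y` between the lines `x + 1` and `x`. -/
def stayWeight (a b c : ℕ) (x y : ℤ) : ℚ :=
  if IsSite a b c x y then (if y - x = 2 * c then 1 / 2 else 1) else 0

/-- The weight of a particle that moves from `y` to `y + 1` between the lines `x + 1` and `x`. -/
def moveWeight (a b c : ℕ) (x y : ℤ) : ℚ :=
  if IsSite a b c x (y + 1) ∧ y + 1 - x ≤ 2 * c then 1 else 0

/-- Past the start point this is Pascal's rule for both summands. On the wall they coincide, and the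
factor 1/2 on the left undoes the doubling. Forbidden steps off the wall start from points where the
path numbers vanish. The bound on `b` keeps the horizontal continuation off the wall. -/
theorem wallPaths_step {a b c j : ℕ} (hb : a + c ≤ b + 1) (hj : j < a) {x y : ℤ} (hx : -(c : ℤ) ≤ x)
    (hs : IsSite a b c (x + 1) y) :
    (if x + 1 + 2 * y = b + 2 * a - 1 then 1 / 2 else 1) *
        wallPaths c (b + 2 * a - 1) j (x + 1) y =
      stayWeight a b c x y * wallPaths c (b + 2 * a - 1) j x y +
        moveWeight a b c x y * wallPaths c (b + 2 * a - 1) j x (y + 1) := by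
  obtain ⟨h1, h2, h3, h4⟩ := hs
  unfold wallPaths
  rcases lt_trichotomy (x + c) j with h | h | h
  · rw [if_pos (show x + 1 + c ≤ j by omega), if_pos h.le, if_pos h.le]
    have e0 : (if x + 1 + 2 * y = b + 2 * a - 1 then 1 / 2 else 1) *
        (if y = c + j then (1 : ℚ) else 0) = if y = c + j then 1 else 0 := by
      split_ifs with hw hy hy
      · omega
      all_goals norm_num
    have e1 : stayWeight a b c x y * (if y = c + j then 1 else 0) = if y = c + j then 1 else 0 := by
      split_ifs with hy
      · rw [stayWeight, if_pos (by unfold IsSite; omega), if_neg (by omega), mul_one]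
      · rw [mul_zero]
    have e2 : moveWeight a b c x y * (if y + 1 = c + j then 1 else 0) = 0 := by
      split_ifs with hy
      · rw [moveWeight, if_neg (by omega), zero_mul]
      · rw [mul_zero]
    rw [e0, e1, e2, add_zero]
  · rw [if_neg (by omega : ¬ x + 1 + c ≤ j), if_pos h.le, if_pos h.le,
      show (x + 1 + c - j - 1).toNat = 0 by omega, halfStart_zero, halfStart_zero]
    have e1 : stayWeight a b c x y * (if y = c + j then 1 else 0) =
        if y = c + j then 1 / 2 else 0 := by
      split_ifs with hy
      · rw [stayWeight, if_pos (by unfold IsSite; omega), if_pos (by omega), mul_one]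
      · rw [mul_zero]
    have e2 : moveWeight a b c x y * (if y + 1 = c + j then 1 else 0) =
        if y + 1 = c + j then 1 else 0 := by
      split_ifs with hy
      · rw [moveWeight, if_pos (by unfold IsSite; omega), mul_one]
      · rw [mul_zero]
    rw [e1, e2]
    split_ifs <;> first | omega | norm_num
  · rw [if_neg (by omega : ¬ x + 1 + c ≤ j), if_neg h.not_ge, if_neg h.not_ge]
    obtain ⟨m, hm⟩ : ∃ m : ℕ, x + c - j - 1 = m := ⟨(x + c - j - 1).toNat, by omega⟩
    rw [show (x + 1 + c - j - 1).toNat = m + 1 by omega, hm, Int.toNat_natCast, halfStart_succ,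
      halfStart_succ]
    obtain ⟨p, hp⟩ : ∃ p : ℤ, p = c + j - y := ⟨_, rfl⟩
    obtain ⟨q, hq⟩ : ∃ q : ℤ, q = c + j - (b + 2 * a - 1 - (x + 1) - y) := ⟨_, rfl⟩
    rw [show (c : ℤ) + j - (b + 2 * a - 1 - x - y) = q - 1 by omega,
      show (c : ℤ) + j - (b + 2 * a - 1 - x - (y + 1)) = q by omega,
      show (c : ℤ) + j - (y + 1) = p - 1 by omega, ← hp, ← hq]
    have e1 : stayWeight a b c x y * (halfStart m p + halfStart m (q - 1)) =
        halfStart m p + halfStart m (q - 1) := by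
      unfold stayWeight
      split_ifs with hy hz
      -- A path past its start point has left the diagonal `y - x = 2c` for good, so the weight 1/2
      -- of other start points does not affect it.
      · rw [halfStart_of_neg (by omega : p < 0), halfStart_of_neg (by omega : q - 1 < 0)]; ring
      · rw [one_mul]
      · unfold IsSite at hy
        rw [halfStart_of_lt (by omega : (m : ℤ) + 1 < p), halfStart_of_neg (by omega : q - 1 < 0)]
        ring
    rw [e1]
    unfold moveWeight
    by_cases hw : x + 1 + 2 * y = b + 2 * a - 1
    · rw [if_pos hw, if_neg (by unfold IsSite; omega), show q = p by omega]
      ring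
    · rw [if_neg hw]
      split_ifs with hy
      · ring
      · unfold IsSite at hy
        rw [halfStart_of_neg (by omega : p - 1 < 0), halfStart_of_neg (by omega : q < 0)]
        ring

/-! ### Column operations on the path determinant -/

theorem sum_reflect_eq_halfStart (m i n : ℕ) (hi : i < n) (r : ℤ) :
    ∑ t ∈ Finset.range n, (halfStart m (r + t) + halfStart m (r - 1 - t)) *
        (if t ≤ i then ((2 * i + 1).choose (i - t) : ℚ) else 0) =
      halfStart (m + (2 * i + 1)) (r + i) := by
  -- Of the `2i + 2` terms of the convolution, those with `l = i - t` and `l = i + 1 + t` share a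
  -- binomial coefficient; they pair up as a term and its mirror image.
  rw [halfStart_add, show 2 * i + 1 + 1 = (i + 1) + (i + 1) by ring, Finset.sum_range_add,
    ← Finset.sum_range_reflect (fun l => ((2 * i + 1).choose l : ℚ) * _), ← Finset.sum_add_distrib,
    ← Finset.sum_subset (Finset.range_mono (Nat.succ_le_of_lt hi))]
  · refine Finset.sum_congr rfl fun t ht => ?_
    rw [Finset.mem_range] at ht
    rw [if_pos (by omega), show i + 1 - 1 - t = i - t by omega,
      ← Nat.choose_symm (show i - t ≤ 2 * i + 1 by omega),
      show 2 * i + 1 - (i - t) = i + 1 + t by omega, Nat.cast_sub (by omega : t ≤ i)]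
    push_cast
    rw [show r + i - ((i : ℤ) - t) = r + t by ring, show r + i - ((i : ℤ) + 1 + t) = r - 1 - t by ring]
    ring
  · intro t _ ht
    rw [Finset.mem_range] at ht
    rw [if_neg (by omega), mul_zero]

/-- After reversal of both indices the entries have the form `f t + f (-1 - t)`. The unitriangular
matrix `C` turns such a column into one `halfStart` with `2i + 1` further steps, to which
`halfStart_eq` applies. -/
theorem det_wallPaths {a b c : ℕ} (hc : 0 < c) (hb : a + c ≤ b + 1) :
    (Matrix.of fun j k : Fin a => wallPaths c (b + 2 * a - 1) j b (k : ℕ)).det =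
      (∏ i ∈ Finset.range a, 1 / 2 * ((b : ℚ) + 2 * c - a + 2 + 3 * i)) *
        catalanValue a (b + 1 - a - c) c := by
  obtain ⟨δ, hδ⟩ : ∃ δ, b + 1 = a + c + δ := ⟨b + 1 - (a + c), by omega⟩
  have hδ' : b + 1 - a - c = δ := by omega
  let C : Matrix (Fin a) (Fin a) ℚ := Matrix.of fun t i =>
    if (t : ℕ) ≤ i then ((2 * (i : ℕ) + 1).choose (i - t) : ℚ) else 0
  have hC : C.det = 1 := by
    rw [Matrix.det_of_isUpperTriangular]
    · simp [C]
    · intro i j hij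
      exact if_neg (not_le.2 hij)
  have hmul (M : Matrix (Fin a) (Fin a) ℚ) : M.det = (M * C).det := by
    rw [Matrix.det_mul, hC, mul_one]
  rw [← Matrix.det_submatrix_equiv_self Fin.revPerm, hδ', ← det_catalanMatrix, hmul,
    ← Fin.prod_univ_eq_prod_range
      (fun i => 1 / 2 * ((b : ℚ) + 2 * c - a + 2 + 3 * i)) a, ← Matrix.det_mul_row]
  congr 1
  ext j i
  simp only [Matrix.mul_apply, Matrix.submatrix_apply, Matrix.of_apply, C, Fin.revPerm_apply,
    Fin.val_rev, catalanMatrix]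
  have hj := j.2
  have hbq : (b : ℚ) = a + c + δ - 1 := by
    have : (b : ℚ) + 1 = a + c + δ := by exact_mod_cast hδ
    linarith
  rw [show 1 / 2 * ((b : ℚ) + 2 * c - a + 2 + 3 * (i : ℕ)) =
    1 / 2 * ((δ : ℚ) + 3 * c + 1 + 3 * (i : ℕ)) by rw [hbq]; ring, ← halfStart_eq]
  have h := sum_reflect_eq_halfStart (2 * c + δ + j - 1) i a i.2 ((c : ℤ) - j)
  rw [show 2 * c + δ + j - 1 + (2 * (i : ℕ) + 1) = 2 * c + δ + j + 2 * i by omega,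
    show (c : ℤ) - j + i = c + i - j by ring, ← Fin.sum_univ_eq_sum_range
      (fun t => (halfStart (2 * c + δ + j - 1) ((c : ℤ) - j + t) +
        halfStart (2 * c + δ + j - 1) ((c : ℤ) - j - 1 - t)) *
        (if t ≤ i then ((2 * (i : ℕ) + 1).choose (i - t) : ℚ) else 0))] at h
  rw [← h]
  refine Finset.sum_congr rfl fun t _ => ?_
  have ht := t.2
  rw [wallPaths, if_neg (by omega)]
  congr 3 <;> omega

/-! ### Tilings with prescribed lozenges -/

theorem isTiling_iff {R : Finset Triangle} {T : Finset Lozenge} :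
    IsTiling R T ↔ (∀ t, ∀ l ∈ T, ∀ l' ∈ T, t ∈ l.cells → t ∈ l'.cells → l = l') ∧
      ∀ t, t ∈ R ↔ ∃ l ∈ T, t ∈ l.cells := by
  unfold IsTiling
  refine and_congr ⟨fun h t l hl l' hl' ht ht' => ?_, fun h l hl l' hl' hne => ?_⟩
    ⟨fun h t => ?_, fun h => ?_⟩
  · by_contra hne
    exact Finset.disjoint_left.1 (h l hl l' hl' hne) ht ht'
  · exact Finset.disjoint_left.2 fun t ht ht' => hne (h t l hl l' hl' ht ht')
  · rw [← h, Finset.mem_biUnion]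
  · ext t
    rw [Finset.mem_biUnion, h]

theorem Lozenge.cells_nonempty (l : Lozenge) : l.cells.Nonempty := by
  cases l <;> exact ⟨_, Finset.mem_insert_self _ _⟩

theorem weightedCount_empty (M : Finset Lozenge) : weightedCount ∅ M = 1 := by
  have h : tilings ∅ = {∅} := by
    ext T
    rw [mem_tilings, isTiling_iff, Finset.mem_singleton]
    refine ⟨fun h => ?_, ?_⟩
    · refine Finset.eq_empty_of_forall_notMem fun l hl => ?_
      obtain ⟨t, ht⟩ := l.cells_nonempty
      exact absurd ((h.2 t).2 ⟨l, hl, ht⟩) (Finset.notMem_empty t)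
    · rintro rfl
      simp
  simp [weightedCount, h]

/-- Removing `Λ` is a bijection onto the tilings of the rest of the region; weights multiply because
the remaining lozenges are disjoint from `Λ`. -/
theorem sum_tilings_superset {R : Finset Triangle} (M : Finset Lozenge) {Λ : Finset Lozenge}
    (hΛ : IsTiling (Λ.biUnion Lozenge.cells) Λ) (hR : Λ.biUnion Lozenge.cells ⊆ R) :
    ∑ T ∈ tilings R with Λ ⊆ T, (1 / 2 : ℚ) ^ (T ∩ M).card =
      (1 / 2) ^ (Λ ∩ M).card * weightedCount (R \ Λ.biUnion Lozenge.cells) M := by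
  have hdisj {T : Finset Lozenge} (hT : IsTiling (R \ Λ.biUnion Lozenge.cells) T) :
      Disjoint T Λ := by
    rw [Finset.disjoint_left]
    intro l hl hl'
    obtain ⟨t, ht⟩ := l.cells_nonempty
    have := ((isTiling_iff.1 hT).2 t).2 ⟨l, hl, ht⟩
    rw [Finset.mem_sdiff] at this
    exact this.2 (Finset.mem_biUnion.2 ⟨l, hl', ht⟩)
  unfold weightedCount
  rw [Finset.mul_sum]
  symm
  refine Finset.sum_bij' (fun T _ => T ∪ Λ) (fun T _ => T \ Λ) ?_ ?_ ?_ ?_ ?_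
  · intro T hT
    rw [mem_tilings] at hT
    rw [Finset.mem_filter, mem_tilings]
    refine ⟨?_, Finset.subset_union_right⟩
    rw [isTiling_iff] at hT hΛ ⊢
    refine ⟨fun t l hl l' hl' ht ht' => ?_, fun t => ?_⟩
    · rw [Finset.mem_union] at hl hl'
      rcases hl with hl | hl <;> rcases hl' with hl' | hl'
      · exact hT.1 t l hl l' hl' ht ht'
      · have := (hT.2 t).2 ⟨l, hl, ht⟩
        rw [Finset.mem_sdiff] at this
        exact absurd (Finset.mem_biUnion.2 ⟨l', hl', ht'⟩) this.2
      · have := (hT.2 t).2 ⟨l', hl', ht'⟩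
        rw [Finset.mem_sdiff] at this
        exact absurd (Finset.mem_biUnion.2 ⟨l, hl, ht⟩) this.2
      · exact hΛ.1 t l hl l' hl' ht ht'
    · constructor
      · intro ht
        by_cases h : t ∈ Λ.biUnion Lozenge.cells
        · obtain ⟨l, hl, hlt⟩ := Finset.mem_biUnion.1 h
          exact ⟨l, Finset.mem_union_right _ hl, hlt⟩
        · obtain ⟨l, hl, hlt⟩ := (hT.2 t).1 (Finset.mem_sdiff.2 ⟨ht, h⟩)
          exact ⟨l, Finset.mem_union_left _ hl, hlt⟩
      · rintro ⟨l, hl, hlt⟩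
        rw [Finset.mem_union] at hl
        rcases hl with hl | hl
        · exact (Finset.mem_sdiff.1 ((hT.2 t).2 ⟨l, hl, hlt⟩)).1
        · exact hR (Finset.mem_biUnion.2 ⟨l, hl, hlt⟩)
  · intro T hT
    rw [Finset.mem_filter, mem_tilings, isTiling_iff] at hT
    rw [mem_tilings, isTiling_iff]
    obtain ⟨⟨h1, h2⟩, h3⟩ := hT
    refine ⟨fun t l hl l' hl' => h1 t l (Finset.sdiff_subset hl) l' (Finset.sdiff_subset hl'),
      fun t => ?_⟩
    rw [Finset.mem_sdiff, h2, Finset.mem_biUnion]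
    constructor
    · rintro ⟨⟨l, hl, hlt⟩, h⟩
      exact ⟨l, Finset.mem_sdiff.2 ⟨hl, fun h' => h ⟨l, h', hlt⟩⟩, hlt⟩
    · rintro ⟨l, hl, hlt⟩
      rw [Finset.mem_sdiff] at hl
      refine ⟨⟨l, hl.1, hlt⟩, ?_⟩
      rintro ⟨l', hl', hlt'⟩
      exact hl.2 (h1 t l hl.1 l' (h3 hl') hlt hlt' ▸ hl')
  · intro T hT
    rw [mem_tilings] at hT
    rw [Finset.union_sdiff_right, Finset.sdiff_eq_self_of_disjoint (hdisj hT)]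
  · intro T hT
    rw [Finset.mem_filter] at hT
    exact Finset.sdiff_union_of_subset hT.2
  · intro T hT
    rw [mem_tilings] at hT
    rw [Finset.union_inter_distrib_right, Finset.card_union_of_disjoint
      ((hdisj hT).mono Finset.inter_subset_left Finset.inter_subset_left), pow_add, mul_comm]

/-- Expansion of a weighted count when each tiling contains exactly one of the sets `Λ i`. -/
theorem weightedCount_eq_sum {ι : Type*} {R : Finset Triangle} (M : Finset Lozenge) (s : Finset ι)
    (Λ : ι → Finset Lozenge) (hex : ∀ T ∈ tilings R, ∃ i ∈ s, Λ i ⊆ T ∧ ∀ j ∈ s, Λ j ⊆ T → j = i)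
    (hΛ : ∀ i ∈ s, IsTiling ((Λ i).biUnion Lozenge.cells) (Λ i))
    (hR : ∀ i ∈ s, (Λ i).biUnion Lozenge.cells ⊆ R) :
    weightedCount R M = ∑ i ∈ s, (1 / 2) ^ (Λ i ∩ M).card *
      weightedCount (R \ (Λ i).biUnion Lozenge.cells) M := by
  rw [Finset.sum_congr rfl fun i hi => (sum_tilings_superset M (hΛ i hi) (hR i hi)).symm]
  simp_rw [Finset.sum_filter]
  rw [Finset.sum_comm]
  refine Finset.sum_congr rfl fun T hT => ?_
  obtain ⟨i, hi, hiT, huniq⟩ := hex T hT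
  rw [Finset.sum_eq_single_of_mem i hi, if_pos hiT]
  intro j hj hne
  exact if_neg fun h => hne (huniq j hj h)

/-! ### The region and the weighted positions -/

theorem mem_nwStaircase_cells {a c : ℕ} {t : Triangle} :
    t ∈ (nwStaircase a c).biUnion Lozenge.cells ↔
      ∃ i j : ℕ, i + j + 1 < a ∧ t ∈ (nwLozenge a c i j).cells := by
  simp only [nwStaircase, Finset.mem_biUnion, Finset.mem_image, Finset.mem_filter,
    Finset.mem_product, Finset.mem_range, Prod.exists]
  constructor
  · rintro ⟨l, ⟨i, j, ⟨-, h⟩, rfl⟩, ht⟩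
    exact ⟨i, j, h, ht⟩
  · rintro ⟨i, j, h, ht⟩
    exact ⟨_, ⟨i, j, ⟨by omega, h⟩, rfl⟩, ht⟩

theorem mem_neStaircase_cells {a b c : ℕ} {t : Triangle} :
    t ∈ (neStaircase a b c).biUnion Lozenge.cells ↔
      ∃ i j : ℕ, i + j + 1 < c ∧ t ∈ (neLozenge a b c i j).cells := by
  simp only [neStaircase, Finset.mem_biUnion, Finset.mem_image, Finset.mem_filter,
    Finset.mem_product, Finset.mem_range, Prod.exists]
  constructor
  · rintro ⟨l, ⟨i, j, ⟨-, h⟩, rfl⟩, ht⟩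
    exact ⟨i, j, h, ht⟩
  · rintro ⟨i, j, h, ht⟩
    exact ⟨_, ⟨i, j, ⟨by omega, h⟩, rfl⟩, ht⟩

/-- The staircases are the parts of the hexagon beyond the diagonals `y - x = 2c` and `x + 2y = b +
2a - 1`. Only the second bound is part of `IsSite`, since particles are continued beyond the first.
-/
theorem up_mem_regionHa {a b c : ℕ} {x y : ℤ} :
    .up x y ∈ regionHa a b c ↔ (-(c : ℤ) ≤ x ∧ x < b) ∧ IsSite a b c x y ∧ y - x ≤ 2 * c := by
  have hnw : Triangle.up x y ∈ (nwStaircase a c).biUnion Lozenge.cells ↔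
      -(c : ℤ) ≤ x ∧ y + 1 ≤ a + c ∧ 2 * c < y - x := by
    rw [mem_nwStaircase_cells]
    simp only [nwLozenge, Lozenge.cells, Finset.mem_insert, Finset.mem_singleton, reduceCtorEq,
      false_or, Triangle.up.injEq]
    constructor
    · rintro ⟨i, j, h⟩
      omega
    · intro h
      exact ⟨(a + c - 1 - y).toNat, (x + c).toNat, by omega, by omega, by omega⟩
  have hne : Triangle.up x y ∈ (neStaircase a b c).biUnion Lozenge.cells ↔
      y + 1 ≤ a + c ∧ x + y < a + b ∧ b + 2 * a - 1 < x + 2 * y := by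
    rw [mem_neStaircase_cells]
    simp only [neLozenge, Lozenge.cells, Finset.mem_insert, Finset.mem_singleton, reduceCtorEq,
      false_or, Triangle.up.injEq]
    constructor
    · rintro ⟨i, j, h⟩
      omega
    · intro h
      exact ⟨(a + c - 1 - y).toNat, (b + a - 1 - x - y).toNat, by omega, by omega, by omega⟩
  rw [regionHa, Finset.mem_sdiff, Finset.union_biUnion, Finset.mem_union, hnw, hne, mem_hexagon]
  simp only [Triangle.vertices, Finset.mem_insert, Finset.mem_singleton, forall_eq_or_imp,
    forall_eq, InHexagon, IsSite]
  omega

theorem down_mem_regionHa {a b c : ℕ} {x y : ℤ} :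
    .down x y ∈ regionHa a b c ↔
      (-(c : ℤ) ≤ x ∧ x < b) ∧ IsSite a b c (x + 1) y ∧ y - x ≤ 2 * c := by
  have hnw : Triangle.down x y ∈ (nwStaircase a c).biUnion Lozenge.cells ↔
      -(c : ℤ) ≤ x ∧ y + 1 ≤ a + c ∧ 2 * c < y - x := by
    rw [mem_nwStaircase_cells]
    simp only [nwLozenge, Lozenge.cells, Finset.mem_insert, Finset.mem_singleton, reduceCtorEq,
      or_false, Triangle.down.injEq]
    constructor
    · rintro ⟨i, j, h⟩
      omega
    · intro h
      exact ⟨(a + c - 1 - y).toNat, (x + c).toNat, by omega, by omega, by omega⟩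
  have hne : Triangle.down x y ∈ (neStaircase a b c).biUnion Lozenge.cells ↔
      y + 1 ≤ a + c ∧ x + 1 + y < a + b ∧ b + 2 * a - 1 < x + 1 + 2 * y := by
    rw [mem_neStaircase_cells]
    simp only [neLozenge, Lozenge.cells, Finset.mem_insert, Finset.mem_singleton, reduceCtorEq,
      or_false, Triangle.down.injEq]
    constructor
    · rintro ⟨i, j, h⟩
      omega
    · intro h
      exact ⟨(a + c - 1 - y).toNat, (b + a - 2 - x - y).toNat, by omega, by omega, by omega⟩
  rw [regionHa, Finset.mem_sdiff, Finset.union_biUnion, Finset.mem_union, hnw, hne, mem_hexagon]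
  simp only [Triangle.vertices, Finset.mem_insert, Finset.mem_singleton, forall_eq_or_imp,
    forall_eq, InHexagon, IsSite]
  omega

theorem left_mem_cuts {a b c : ℕ} {x y : ℤ} :
    .left x y ∈ nwCut a c ∪ neCut a b c ↔ -(c : ℤ) ≤ x ∧ y + 1 ≤ a + c ∧ y - x = 2 * c := by
  simp only [nwCut, neCut, nwLozenge, neLozenge, Finset.mem_union, Finset.mem_image,
    Finset.mem_filter, Finset.mem_product, Finset.mem_range, Prod.exists, Lozenge.left.injEq,
    reduceCtorEq, and_false, exists_false, or_false]
  constructor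
  · rintro ⟨i, j, h⟩
    omega
  · intro h
    exact ⟨(a + c - 1 - y).toNat, (x + c).toNat, by omega, by omega, by omega⟩

theorem right_mem_cuts {a b c : ℕ} {x y : ℤ} :
    .right (x - 1) y ∈ nwCut a c ∪ neCut a b c ↔
      (a : ℤ) ≤ y ∧ y + 1 ≤ a + c ∧ x + 2 * y = b + 2 * a - 1 := by
  simp only [nwCut, neCut, nwLozenge, neLozenge, Finset.mem_union, Finset.mem_image,
    Finset.mem_filter, Finset.mem_product, Finset.mem_range, Prod.exists, Lozenge.right.injEq,
    reduceCtorEq, and_false, exists_false, false_or]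
  constructor
  · rintro ⟨i, j, h⟩
    omega
  · intro h
    exact ⟨(a + c - 1 - y).toNat, (y - a).toNat, by omega, by omega, by omega⟩

theorem top_notMem_cuts {a b c : ℕ} {x y : ℤ} : .top x y ∉ nwCut a c ∪ neCut a b c := by
  simp [nwCut, neCut, nwLozenge, neLozenge]

/-! ### Peeling off a vertical strip -/

open Classical in
/-- The part of the region `H_a(a,b,c)` to the left of the line with first coordinate `x`, without the
triangles that are covered by lozenges crossing this line when its particles are at `s`. -/
noncomputable def remaining (a b c : ℕ) (x : ℤ) (s : Fin a → ℤ) : Finset Triangle :=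
  {t ∈ regionHa a b c | match t with
    | .up x' _ => x' < x
    | .down x' y => x' < x ∧ (x' + 1 = x → ∃ k, s k = y)}

theorem up_mem_remaining {a b c : ℕ} {x x' y : ℤ}
    {s : Fin a → ℤ} : .up x' y ∈ remaining a b c x s ↔
      ((-(c : ℤ) ≤ x' ∧ x' < b) ∧ IsSite a b c x' y ∧ y - x' ≤ 2 * c) ∧ x' < x := by
  simp only [remaining, Finset.mem_filter, up_mem_regionHa]

theorem down_mem_remaining {a b c : ℕ} {x x' y : ℤ}
    {s : Fin a → ℤ} : .down x' y ∈ remaining a b c x s ↔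
      ((-(c : ℤ) ≤ x' ∧ x' < b) ∧ IsSite a b c (x' + 1) y ∧ y - x' ≤ 2 * c) ∧
        x' < x ∧ (x' + 1 = x → ∃ k, s k = y) := by
  simp only [remaining, Finset.mem_filter, down_mem_regionHa]

/-- The positions `s` of the particles after those in `ε` have moved up by `1`. -/
def moved {a : ℕ} (s : Fin a → ℤ) (ε : Finset (Fin a)) (k : Fin a) : ℤ :=
  if k ∈ ε then s k + 1 else s k

/-- The lozenges which meet the strip between the lines `x` and `x + 1` and do not cross the line
`x + 1`, when the particles on the line `x + 1` are at `s` and those on the line `x` at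
`moved s ε`. -/
noncomputable def stripLozenges (a b c : ℕ) (x : ℤ) (s : Fin a → ℤ) (ε : Finset (Fin a)) : Finset Lozenge :=
  {k ∈ εᶜ | s k - x ≤ 2 * c}.image (fun k => .left x (s k)) ∪ ε.image (fun k => .top x (s k)) ∪
    {y ∈ Finset.Icc (0 : ℤ) (a + c) | IsSite a b c x y ∧ y - x ≤ 2 * c ∧ ∀ k, moved s ε k ≠ y}.image
      (fun y => .right (x - 1) y)

section mem_stripLozenges

variable {a b c : ℕ} {x x' y : ℤ} {s : Fin a → ℤ} {ε : Finset (Fin a)}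

theorem left_mem_stripLozenges : .left x' y ∈ stripLozenges a b c x s ε ↔
    x' = x ∧ y - x ≤ 2 * c ∧ ∃ k ∉ ε, s k = y := by
  simp only [stripLozenges, Finset.mem_union, Finset.mem_image, Finset.mem_filter,
    Finset.mem_compl, Lozenge.left.injEq, reduceCtorEq, and_false, exists_false, or_false]
  constructor
  · rintro ⟨k, ⟨h1, h2⟩, rfl, rfl⟩
    exact ⟨rfl, h2, k, h1, rfl⟩
  · rintro ⟨rfl, h2, k, h1, rfl⟩
    exact ⟨k, ⟨h1, h2⟩, rfl, rfl⟩

theorem top_mem_stripLozenges : .top x' y ∈ stripLozenges a b c x s ε ↔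
    x' = x ∧ ∃ k ∈ ε, s k = y := by
  simp only [stripLozenges, Finset.mem_union, Finset.mem_image,
    Lozenge.top.injEq, reduceCtorEq, and_false, exists_false, or_false, false_or]
  constructor
  · rintro ⟨k, h1, rfl, rfl⟩
    exact ⟨rfl, k, h1, rfl⟩
  · rintro ⟨rfl, k, h1, rfl⟩
    exact ⟨k, h1, rfl, rfl⟩

theorem right_mem_stripLozenges : .right x' y ∈ stripLozenges a b c x s ε ↔
    x' = x - 1 ∧ IsSite a b c x y ∧ y - x ≤ 2 * c ∧ ∀ k, moved s ε k ≠ y := by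
  simp only [stripLozenges, Finset.mem_union, Finset.mem_image, Finset.mem_filter, Finset.mem_Icc,
    Lozenge.right.injEq, reduceCtorEq, and_false, exists_false, false_or]
  constructor
  · rintro ⟨z, ⟨-, h⟩, rfl, rfl⟩
    exact ⟨rfl, h⟩
  · rintro ⟨rfl, h⟩
    exact ⟨y, ⟨by have := h.1; unfold IsSite at this; omega, h⟩, rfl, rfl⟩

end mem_stripLozenges

/-- The moves of particles that come from tilings. -/
structure IsMove (a b c : ℕ) (x : ℤ) (s : Fin a → ℤ) (ε : Finset (Fin a)) : Prop where
  move : ∀ k ∈ ε, IsSite a b c x (s k + 1) ∧ s k + 1 - x ≤ 2 * c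
  stay : ∀ k ∉ ε, IsSite a b c x (s k)
  strictMono : StrictMono (moved s ε)
  -- A lozenge crossing the line here would need the triangle `down (x - 1) (x + 2c)`, which is
  -- outside the region. So the indentation holds a particle: the start of a path.
  corner : IsSite a b c x (x + 2 * c) → ∃ k, moved s ε k = x + 2 * c

theorem up_mem_cells {x y : ℤ} {l : Lozenge} :
    .up x y ∈ l.cells ↔ l = .left x y ∨ l = .right (x - 1) y ∨ l = .top x (y - 1) := by
  cases l <;> simp [Lozenge.cells] <;> omega

theorem down_mem_cells {x y : ℤ} {l : Lozenge} :
    .down x y ∈ l.cells ↔ l = .left x y ∨ l = .right x y ∨ l = .top x y := by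
  cases l <;> simp [Lozenge.cells] <;> omega

section strip

variable {a b c : ℕ} {x : ℤ} {s : Fin a → ℤ} {ε : Finset (Fin a)}

theorem IsMove.isTiling (h : IsMove a b c x s ε) (hs : StrictMono s) :
    IsTiling ((stripLozenges a b c x s ε).biUnion Lozenge.cells) (stripLozenges a b c x s ε) := by
  rw [isTiling_iff]
  refine ⟨fun t l hl l' hl' ht ht' => ?_, fun t => Finset.mem_biUnion⟩
  have hinj := hs.injective
  have hinj' := h.strictMono.injective
  cases t with
  | up x' y =>
    have hm : ∀ l ∈ stripLozenges a b c x s ε, .up x' y ∈ l.cells →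
        (l = .left x' y ∧ ∃ k ∉ ε, moved s ε k = y) ∨ (l = .top x' (y - 1) ∧ ∃ k ∈ ε, moved s ε k = y) ∨
          (l = .right (x' - 1) y ∧ ∀ k, moved s ε k ≠ y) := by
      intro l hl ht
      rcases up_mem_cells.1 ht with rfl | rfl | rfl
      · obtain ⟨rfl, -, k, hk, rfl⟩ := left_mem_stripLozenges.1 hl
        exact .inl ⟨rfl, k, hk, if_neg hk⟩
      · exact .inr (.inr ⟨rfl, (right_mem_stripLozenges.1 hl).2.2.2⟩)
      · obtain ⟨rfl, k, hk, hky⟩ := top_mem_stripLozenges.1 hl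
        exact .inr (.inl ⟨rfl, k, hk, by rw [moved, if_pos hk, hky]; ring⟩)
    rcases hm l hl ht with ⟨rfl, k, hk, hky⟩ | ⟨rfl, k, hk, hky⟩ | ⟨rfl, hk⟩ <;>
    rcases hm l' hl' ht' with ⟨rfl, k', hk', hky'⟩ | ⟨rfl, k', hk', hky'⟩ | ⟨rfl, hk'⟩
    · rfl
    · exact absurd (hinj' (hky'.trans hky.symm) ▸ hk') hk
    · exact absurd hky (hk' k)
    · exact absurd (hinj' (hky.trans hky'.symm) ▸ hk) hk'
    · rfl
    · exact absurd hky (hk' k)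
    · exact absurd hky' (hk k')
    · exact absurd hky' (hk k')
    · rfl
  | down x' y =>
    have hm : ∀ l ∈ stripLozenges a b c x s ε, .down x' y ∈ l.cells →
        (l = .left x' y ∧ x' = x ∧ ∃ k ∉ ε, s k = y) ∨ (l = .top x' y ∧ x' = x ∧ ∃ k ∈ ε, s k = y) ∨
          (l = .right x' y ∧ x' = x - 1) := by
      intro l hl ht
      rcases down_mem_cells.1 ht with rfl | rfl | rfl
      · obtain ⟨h1, -, h2⟩ := left_mem_stripLozenges.1 hl
        exact .inl ⟨rfl, h1, h2⟩
      · exact .inr (.inr ⟨rfl, (right_mem_stripLozenges.1 hl).1⟩)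
      · exact .inr (.inl ⟨rfl, top_mem_stripLozenges.1 hl⟩)
    rcases hm l hl ht with ⟨rfl, hx, k, hk, hky⟩ | ⟨rfl, hx, k, hk, hky⟩ | ⟨rfl, hx⟩ <;>
    rcases hm l' hl' ht' with ⟨rfl, hx', k', hk', hky'⟩ | ⟨rfl, hx', k', hk', hky'⟩ | ⟨rfl, hx'⟩
    · rfl
    · exact absurd (hinj (hky'.trans hky.symm) ▸ hk') hk
    · omega
    · exact absurd (hinj (hky.trans hky'.symm) ▸ hk) hk'
    · rfl
    · omega
    · omega
    · omega
    · rfl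

theorem IsMove.up_mem_biUnion_cells (h : IsMove a b c x s ε) {x' y : ℤ} :
    .up x' y ∈ (stripLozenges a b c x s ε).biUnion Lozenge.cells ↔
      x' = x ∧ IsSite a b c x y ∧ y - x ≤ 2 * c := by
  rw [Finset.mem_biUnion]
  constructor
  · rintro ⟨l, hl, ht⟩
    rcases up_mem_cells.1 ht with rfl | rfl | rfl
    · obtain ⟨rfl, h1, k, hk, rfl⟩ := left_mem_stripLozenges.1 hl
      exact ⟨rfl, h.stay k hk, h1⟩
    · obtain ⟨h1, h2, h3, -⟩ := right_mem_stripLozenges.1 hl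
      exact ⟨by omega, h2, h3⟩
    · obtain ⟨rfl, k, hk, hky⟩ := top_mem_stripLozenges.1 hl
      have := h.move k hk
      rw [hky, sub_add_cancel] at this
      exact ⟨rfl, this⟩
  · rintro ⟨rfl, h1, h2⟩
    by_cases hk : ∃ k, moved s ε k = y
    · obtain ⟨k, hk⟩ := hk
      by_cases hkε : k ∈ ε
      · rw [moved, if_pos hkε] at hk
        exact ⟨_, top_mem_stripLozenges.2 ⟨rfl, k, hkε, rfl⟩, up_mem_cells.2
          (.inr (.inr (by rw [← hk, add_sub_cancel_right])))⟩
      · rw [moved, if_neg hkε] at hk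
        exact ⟨_, left_mem_stripLozenges.2 ⟨rfl, h2, k, hkε, hk⟩, up_mem_cells.2 (.inl rfl)⟩
    · push Not at hk
      exact ⟨_, right_mem_stripLozenges.2 ⟨rfl, h1, h2, hk⟩, up_mem_cells.2 (.inr (.inl rfl))⟩

theorem IsMove.down_mem_biUnion_cells (h : IsMove a b c x s ε) {x' y : ℤ} :
    .down x' y ∈ (stripLozenges a b c x s ε).biUnion Lozenge.cells ↔
      (x' = x ∧ y - x ≤ 2 * c ∧ ∃ k, s k = y) ∨
      (x' = x - 1 ∧ IsSite a b c x y ∧ y - x ≤ 2 * c ∧ ∀ k, moved s ε k ≠ y) := by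
  rw [Finset.mem_biUnion]
  constructor
  · rintro ⟨l, hl, ht⟩
    rcases down_mem_cells.1 ht with rfl | rfl | rfl
    · obtain ⟨rfl, h1, k, hk, rfl⟩ := left_mem_stripLozenges.1 hl
      exact .inl ⟨rfl, h1, k, rfl⟩
    · exact .inr (right_mem_stripLozenges.1 hl)
    · obtain ⟨rfl, k, hk, rfl⟩ := top_mem_stripLozenges.1 hl
      have := (h.move k hk).2
      exact .inl ⟨rfl, by omega, k, rfl⟩
  · rintro (⟨rfl, h1, k, rfl⟩ | h1)
    · by_cases hkε : k ∈ ε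
      · exact ⟨_, top_mem_stripLozenges.2 ⟨rfl, k, hkε, rfl⟩, down_mem_cells.2 (.inr (.inr rfl))⟩
      · exact ⟨_, left_mem_stripLozenges.2 ⟨rfl, h1, k, hkε, rfl⟩, down_mem_cells.2 (.inl rfl)⟩
    · exact ⟨_, right_mem_stripLozenges.2 h1, down_mem_cells.2 (.inr (.inl rfl))⟩

end strip

section strip_remaining

variable {a b c : ℕ} {x : ℤ} {s : Fin a → ℤ} {ε : Finset (Fin a)}

theorem IsMove.biUnion_cells_subset
    (hx : -(c : ℤ) ≤ x) (hxb : x < b) (hsite : ∀ k, IsSite a b c (x + 1) (s k))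
    (h : IsMove a b c x s ε) :
    (stripLozenges a b c x s ε).biUnion Lozenge.cells ⊆ remaining a b c (x + 1) s := by
  intro t ht
  cases t with
  | up x' y =>
    obtain ⟨rfl, h1, h2⟩ := h.up_mem_biUnion_cells.1 ht
    exact (up_mem_remaining).2 ⟨⟨⟨hx, hxb⟩, h1, h2⟩, by omega⟩
  | down x' y =>
    rw [down_mem_remaining]
    rcases h.down_mem_biUnion_cells.1 ht with ⟨rfl, h1, k, rfl⟩ | ⟨rfl, h1, h2, h3⟩
    · exact ⟨⟨⟨hx, hxb⟩, hsite k, h1⟩, by omega, fun _ => ⟨k, rfl⟩⟩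
    · have hne : y ≠ x + 2 * c := by
        rintro rfl
        obtain ⟨k, hk⟩ := h.corner h1
        exact h3 k hk
      have hxc : x ≠ -c := by
        rintro rfl
        unfold IsSite at h1
        omega
      exact ⟨⟨by omega, by rwa [sub_add_cancel], by omega⟩, by omega, by omega⟩

theorem IsMove.remaining_sdiff
    (h : IsMove a b c x s ε) :
    remaining a b c (x + 1) s \ (stripLozenges a b c x s ε).biUnion Lozenge.cells =
      remaining a b c x (moved s ε) := by
  ext t
  rw [Finset.mem_sdiff]
  cases t with
  | up x' y =>
    rw [h.up_mem_biUnion_cells, up_mem_remaining, up_mem_remaining]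
    constructor
    · rintro ⟨⟨h1, h2⟩, h3⟩
      refine ⟨h1, lt_of_le_of_ne (by omega) ?_⟩
      rintro rfl
      exact h3 ⟨rfl, h1.2⟩
    · rintro ⟨h1, h2⟩
      exact ⟨⟨h1, by omega⟩, fun h3 => by omega⟩
  | down x' y =>
    rw [h.down_mem_biUnion_cells, down_mem_remaining, down_mem_remaining]
    constructor
    · rintro ⟨⟨h1, h2, h3⟩, h4⟩
      have hne : x' ≠ x := by
        rintro rfl
        exact h4 (.inl ⟨rfl, h1.2.2, h3 rfl⟩)
      refine ⟨h1, by omega, ?_⟩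
      rintro rfl
      by_contra hk
      push Not at hk
      exact h4 (.inr ⟨by omega, h1.2.1, by omega, hk⟩)
    · rintro ⟨h1, h2, h3⟩
      refine ⟨⟨h1, by omega, by omega⟩, ?_⟩
      rintro (h4 | ⟨rfl, -, -, h4⟩)
      · omega
      · obtain ⟨k, hk⟩ := h3 (by ring)
        exact h4 k hk

/-- The moving particles are read off from the top lozenges. The rest of the strip is forced,
because the downward triangle at a particle cannot be joined to its right. -/
theorem exists_isMove
    (hx : -(c : ℤ) ≤ x) (hxb : x < b) (hs : StrictMono s)
    (hsite : ∀ k, IsSite a b c (x + 1) (s k)) {T : Finset Lozenge}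
    (hT : T ∈ tilings (remaining a b c (x + 1) s)) :
    ∃ ε, IsMove a b c x s ε ∧ stripLozenges a b c x s ε ⊆ T ∧
      ∀ ε', IsMove a b c x s ε' → stripLozenges a b c x s ε' ⊆ T → ε' = ε := by
  classical
  rw [mem_tilings, isTiling_iff] at hT
  obtain ⟨hu, hcov⟩ := hT
  have hup {l : Lozenge} {x' y : ℤ} (hl : l ∈ T) (ht : .up x' y ∈ l.cells) :=
    (up_mem_remaining).1 ((hcov _).2 ⟨l, hl, ht⟩)
  have hdown {l : Lozenge} {x' y : ℤ} (hl : l ∈ T) (ht : .down x' y ∈ l.cells) :=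
    (down_mem_remaining).1 ((hcov _).2 ⟨l, hl, ht⟩)
  let ε : Finset (Fin a) := {k | .top x (s k) ∈ T}
  have hε (k) : k ∈ ε ↔ .top x (s k) ∈ T := by simp [ε]
  have htop (k) (hk : k ∈ ε) : IsSite a b c x (s k + 1) ∧ s k + 1 - x ≤ 2 * c :=
    (hup ((hε k).1 hk) (up_mem_cells.2 (.inr (.inr (by rw [add_sub_cancel_right]))))).1.2
  have hleft (k) (hk : k ∉ ε) (hreal : s k - x ≤ 2 * c) : .left x (s k) ∈ T := by
    obtain ⟨l, hl, hlt⟩ := (hcov (.down x (s k))).1 ((down_mem_remaining).2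
      ⟨⟨⟨hx, hxb⟩, hsite k, hreal⟩, by omega, fun _ => ⟨k, rfl⟩⟩)
    rcases down_mem_cells.1 hlt with rfl | rfl | rfl
    · exact hl
    · have := (hup hl (x' := x + 1) (y := s k)
        (up_mem_cells.2 (.inr (.inl (by rw [add_sub_cancel_right]))))).2
      omega
    · exact absurd ((hε k).2 hl) hk
  have hsk {y : ℤ} {l : Lozenge} (hl : l ∈ T) (ht : .down x y ∈ l.cells) : ∃ k, s k = y :=
    (hdown hl ht).2.2 rfl
  have hnot (k) (hl : .left x (s k) ∈ T) : k ∉ ε := fun hk => by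
    have := hu (.down x (s k)) _ hl _ ((hε k).1 hk) (by simp [Lozenge.cells])
      (by simp [Lozenge.cells])
    simp at this
  have hoccupied {y : ℤ} (h1 : IsSite a b c x y) (h2 : y - x ≤ 2 * c) :
      .right (x - 1) y ∈ T ∨ ∃ k, moved s ε k = y := by
    obtain ⟨l, hl, hlt⟩ := (hcov (.up x y)).1 ((up_mem_remaining).2
      ⟨⟨⟨hx, hxb⟩, h1, h2⟩, by omega⟩)
    rcases up_mem_cells.1 hlt with rfl | rfl | rfl
    · obtain ⟨k, rfl⟩ := hsk hl (down_mem_cells.2 (.inl rfl))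
      exact .inr ⟨k, if_neg (hnot k hl)⟩
    · exact .inl hl
    · obtain ⟨k, hk⟩ := hsk hl (down_mem_cells.2 (.inr (.inr rfl)))
      refine .inr ⟨k, ?_⟩
      rw [moved, if_pos ((hε k).2 (hk ▸ hl)), hk, sub_add_cancel]
  refine ⟨ε, ⟨htop, fun k hk => ?_, ?_, fun h => ?_⟩, ?_, fun ε' hε' hsub => ?_⟩
  -- Beyond the northwestern cut there are no triangles, and the particle is only a horizontal
  -- continuation.
  · by_cases hreal : s k - x ≤ 2 * c
    · exact (hup (hleft k hk hreal) (up_mem_cells.2 (.inl rfl))).1.2.1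
    · have := hsite k
      unfold IsSite at this ⊢
      omega
  · intro k l hkl
    have hlt := hs hkl
    by_contra hcon
    have hk : k ∈ ε := by
      by_contra hk
      rw [moved, if_neg hk, moved] at hcon
      split_ifs at hcon <;> omega
    have hl : l ∉ ε := by
      intro hl
      rw [moved, if_pos hk, moved, if_pos hl] at hcon
      omega
    rw [moved, if_pos hk, moved, if_neg hl] at hcon
    -- The only possible collision: the lower particle moves up to where the higher one stays, and
    -- their lozenges overlap.
    have heq : s l = s k + 1 := by omega
    have h1 := hleft l hl (by have := (htop k hk).2; omega)
    have := hu (.up x (s l)) _ h1 _ ((hε k).1 hk) (by simp [Lozenge.cells])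
      (by simp [Lozenge.cells, heq])
    simp at this
  · rcases hoccupied h (by omega) with h1 | h1
    · have := (hdown h1 (x' := x - 1) (y := x + 2 * c) (by simp [Lozenge.cells])).1.2.2
      omega
    · exact h1
  · intro l hl
    cases l with
    | left x' y =>
      obtain ⟨rfl, h1, k, hk, rfl⟩ := left_mem_stripLozenges.1 hl
      exact hleft k hk h1
    | right x' y =>
      obtain ⟨rfl, h1, h2, h3⟩ := right_mem_stripLozenges.1 hl
      rcases hoccupied h1 h2 with h4 | ⟨k, hk⟩
      · exact h4
      · exact absurd hk (h3 k)
    | top x' y =>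
      obtain ⟨rfl, k, hk, rfl⟩ := top_mem_stripLozenges.1 hl
      exact (hε k).1 hk
  · ext k
    constructor
    · intro hk
      exact (hε k).2 (hsub (top_mem_stripLozenges.2 ⟨rfl, k, hk, rfl⟩))
    · intro hk
      by_contra hk'
      refine hnot k (hsub (left_mem_stripLozenges.2 ⟨rfl, ?_, k, hk', rfl⟩)) hk
      have := (htop k hk).2
      omega

end strip_remaining

/-! ### The recursion for weighted counts -/

open Classical in
/-- The weight of the lozenge at the northeastern cut that crosses the line `x`, if there is such a
lozenge when the particles on this line are at `s`. -/
noncomputable def holeWeight (a b c : ℕ) (x : ℤ) (s : Fin a → ℤ) : ℚ :=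
  if ∃ y, x + 2 * y = b + 2 * a - 1 ∧ IsSite a b c x y ∧ ∀ k, s k ≠ y then 1 / 2 else 1

/-- The weight of a particle that stays at `y` in the strip between the lines `x` and `x + 1`, due to
the northwestern cut. -/
def cornerWeight (c : ℕ) (x y : ℤ) : ℚ := if y - x = 2 * c then 1 / 2 else 1

theorem half_pow_card_inter (Λ M : Finset Lozenge) :
    (1 / 2 : ℚ) ^ (Λ ∩ M).card = ∏ l ∈ Λ, if l ∈ M then 1 / 2 else 1 := by
  rw [Finset.prod_ite_mem, Finset.prod_const]

section weights

variable {a b c : ℕ} {x : ℤ} {s : Fin a → ℤ} {ε : Finset (Fin a)}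

theorem weight_stripLozenges (hb : a + c ≤ b + 1) (hxb : x < b)
    (hs : StrictMono s) (h : IsMove a b c x s ε) :
    (1 / 2 : ℚ) ^ (stripLozenges a b c x s ε ∩ (nwCut a c ∪ neCut a b c)).card =
      (∏ k ∈ εᶜ, cornerWeight c x (s k)) * holeWeight a b c x (moved s ε) := by
  rw [half_pow_card_inter, stripLozenges, Finset.prod_union, Finset.prod_union, Finset.prod_image,
    Finset.prod_image, Finset.prod_image]
  · congr 1
    · rw [Finset.prod_eq_one (s := ε) fun k _ => if_neg top_notMem_cuts, mul_one,
        Finset.prod_filter]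
      refine Finset.prod_congr rfl fun k hk => ?_
      have hsite := h.stay k (Finset.mem_compl.1 hk)
      unfold IsSite at hsite
      rw [cornerWeight]
      split_ifs with h1 h2 h3 h3 h3 <;> try rfl
      · rw [left_mem_cuts] at h2; omega
      · rw [left_mem_cuts] at h2; omega
      · omega
    · unfold holeWeight
      split_ifs with hw
      · obtain ⟨y, h1, h2, h3⟩ := hw
        have h2' := h2
        unfold IsSite at h2'
        rw [Finset.prod_eq_single_of_mem y, if_pos (right_mem_cuts.2 (by omega))]
        · rw [Finset.mem_filter, Finset.mem_Icc]
          exact ⟨by omega, h2, by omega, h3⟩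
        · intro z _ hz
          exact if_neg fun h => hz (by have := right_mem_cuts.1 h; omega)
      · refine Finset.prod_eq_one fun y hy => if_neg fun hy' => hw ?_
        rw [Finset.mem_filter] at hy
        exact ⟨y, (right_mem_cuts.1 hy').2.2, hy.2.1, hy.2.2.2⟩
  · intro y _ z _ hyz
    simpa using hyz
  · intro k _ l _ hkl
    exact hs.injective (by simpa using hkl)
  · intro k _ l _ hkl
    exact hs.injective (by simpa using hkl)
  · rw [Finset.disjoint_left]
    intro l hl hl'
    simp only [Finset.mem_image] at hl hl'
    obtain ⟨k, -, rfl⟩ := hl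
    obtain ⟨k', -, h⟩ := hl'
    simp at h
  · rw [Finset.disjoint_left]
    intro l hl hl'
    simp only [Finset.mem_union, Finset.mem_image] at hl hl'
    obtain ⟨y, -, rfl⟩ := hl'
    rcases hl with ⟨k, -, h⟩ | ⟨k, -, h⟩ <;> simp at h

open Classical in
theorem weightedCount_remaining_succ (hb : a + c ≤ b + 1) (hx : -(c : ℤ) ≤ x) (hxb : x < b)
    (hs : StrictMono s) (hsite : ∀ k, IsSite a b c (x + 1) (s k)) :
    weightedCount (remaining a b c (x + 1) s) (nwCut a c ∪ neCut a b c) =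
      ∑ ε : Finset (Fin a) with IsMove a b c x s ε,
        (∏ k ∈ εᶜ, cornerWeight c x (s k)) * (weightedCount (remaining a b c x (moved s ε))
          (nwCut a c ∪ neCut a b c) * holeWeight a b c x (moved s ε)) := by
  rw [weightedCount_eq_sum _ {ε : Finset (Fin a) | IsMove a b c x s ε} (stripLozenges a b c x s)]
  · refine Finset.sum_congr rfl fun ε hε => ?_
    have hε := (Finset.mem_filter.1 hε).2
    rw [weight_stripLozenges hb hxb hs hε, hε.remaining_sdiff]
    ring
  · intro T hT
    obtain ⟨ε, h1, h2, h3⟩ := exists_isMove hx hxb hs hsite hT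
    exact ⟨ε, by simpa using h1, h2, fun ε' hε' => h3 ε' (Finset.mem_filter.1 hε').2⟩
  · exact fun ε hε => (Finset.mem_filter.1 hε).2.isTiling hs
  · exact fun ε hε => (Finset.mem_filter.1 hε).2.biUnion_cells_subset hx hxb hsite

/-! ### The recursion for determinants of path numbers -/

/-- The weighted path numbers from the start points to the particles `s` on the line `x`. -/
def pathMatrix (a b c : ℕ) (x : ℤ) (s : Fin a → ℤ) : Matrix (Fin a) (Fin a) ℚ :=
  Matrix.of fun k j => wallPaths c (b + 2 * a - 1) j x (s k)

/-- The factor which compensates for the weight `2` of visits of the wall. -/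
def wallWeight (a b : ℕ) (x y : ℤ) : ℚ := if x + 2 * y = b + 2 * a - 1 then 1 / 2 else 1

theorem monotone_moved (hs : StrictMono s) (ε : Finset (Fin a)) : Monotone (moved s ε) := by
  intro k l hkl
  rcases hkl.eq_or_lt with rfl | hkl
  · exact le_rfl
  · have := hs hkl
    unfold moved
    split_ifs <;> omega

open Classical in
-- A choice of moves that comes from no tiling contributes 0 for one of three reasons: a step has
-- weight 0, two particles collide and two rows agree, or an indentation stays empty and the column
-- of its start point vanishes.
theorem prod_mul_det_pathMatrix_moved (hx : -(c : ℤ) ≤ x) (hs : StrictMono s)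
    (ε : Finset (Fin a)) :
    (∏ k, if k ∈ ε then moveWeight a b c x (s k) else stayWeight a b c x (s k)) *
        (pathMatrix a b c x (moved s ε)).det =
      if IsMove a b c x s ε then
        (∏ k ∈ εᶜ, cornerWeight c x (s k)) * (pathMatrix a b c x (moved s ε)).det else 0 := by
  split_ifs with h
  · congr 1
    rw [← Finset.prod_subset (Finset.subset_univ εᶜ)]
    · refine Finset.prod_congr rfl fun k hk => ?_
      have hk := Finset.mem_compl.1 hk
      rw [if_neg hk, stayWeight, if_pos (h.stay k hk), cornerWeight]
    · intro k _ hk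
      have hk : k ∈ ε := by simpa using hk
      rw [if_pos hk, moveWeight, if_pos (h.move k hk)]
  · by_cases h1 : ∀ k ∈ ε, IsSite a b c x (s k + 1) ∧ s k + 1 - x ≤ 2 * c
    · by_cases h2 : ∀ k ∉ ε, IsSite a b c x (s k)
      · refine mul_eq_zero_of_right _ ?_
        by_cases h3 : StrictMono (moved s ε)
        · have h4 : ¬ (IsSite a b c x (x + 2 * c) → ∃ k, moved s ε k = x + 2 * c) :=
            fun h4 => h ⟨h1, h2, h3, h4⟩
          push Not at h4
          obtain ⟨h4, h5⟩ := h4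
          unfold IsSite at h4
          -- The start point on the line `x` has index `x + c`.
          have hj : (x + c).toNat < a := by omega
          refine Matrix.det_eq_zero_of_column_eq_zero ⟨_, hj⟩ fun k => ?_
          have := h5 k
          rw [pathMatrix, Matrix.of_apply, wallPaths, if_pos (by simp), if_neg]
          intro h6
          simp only at h6
          omega
        · have hni : ¬ Function.Injective (moved s ε) := fun hi =>
            h3 ((monotone_moved hs ε).strictMono_of_injective hi)
          simp only [Function.Injective, not_forall] at hni
          obtain ⟨k, l, hkl, hne⟩ := hni
          refine Matrix.det_zero_of_row_eq hne ?_
          ext j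
          simp [pathMatrix, hkl]
      · push Not at h2
        obtain ⟨k, hk, hks⟩ := h2
        refine mul_eq_zero_of_left (Finset.prod_eq_zero (Finset.mem_univ k) ?_) _
        rw [if_neg hk, stayWeight, if_neg hks]
    · simp only [not_forall] at h1
      obtain ⟨k, hk, hks⟩ := h1
      refine mul_eq_zero_of_left (Finset.prod_eq_zero (Finset.mem_univ k) ?_) _
      rw [if_pos hk, moveWeight, if_neg hks]

open Classical in
-- By `wallPaths_step` each weighted row is a sum of a moving and a staying row; multilinearity
-- expands the determinant over all subsets `ε`.
theorem det_pathMatrix_succ (hb : a + c ≤ b + 1) (hx : -(c : ℤ) ≤ x)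
    (hs : StrictMono s) (hsite : ∀ k, IsSite a b c (x + 1) (s k)) :
    (∏ k, wallWeight a b (x + 1) (s k)) * (pathMatrix a b c (x + 1) s).det =
      ∑ ε : Finset (Fin a) with IsMove a b c x s ε,
        (∏ k ∈ εᶜ, cornerWeight c x (s k)) * (pathMatrix a b c x (moved s ε)).det := by
  rw [Finset.sum_filter, ← Matrix.det_mul_column]
  simp_rw [← prod_mul_det_pathMatrix_moved hx hs]
  let m : Matrix (Fin a) (Fin a) ℚ := Matrix.of fun k j =>
    moveWeight a b c x (s k) * wallPaths c (b + 2 * a - 1) j x (s k + 1)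
  let m' : Matrix (Fin a) (Fin a) ℚ := Matrix.of fun k j =>
    stayWeight a b c x (s k) * wallPaths c (b + 2 * a - 1) j x (s k)
  have hm : (Matrix.of fun k j => wallWeight a b (x + 1) (s k) * pathMatrix a b c (x + 1) s k j) =
      m + m' := by
    ext k j
    exact (wallPaths_step hb j.2 hx (hsite k)).trans (add_comm _ _)
  rw [hm]
  have hadd := (Matrix.detRowAlternating (n := Fin a) (R := ℚ)).map_add_univ m m'
  refine hadd.trans (Finset.sum_congr rfl fun ε _ => ?_)
  rw [← Matrix.det_mul_column]
  refine congrArg Matrix.det ?_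
  ext k j
  simp only [Finset.piecewise, Matrix.of_apply, pathMatrix, moved, m, m']
  split_ifs <;> rfl

/-! ### Weighted counts as determinants -/

/-- The product of the weights `1/2` of the positions along the part of the northeastern cut to the
left of the line `x`. -/
noncomputable def wallFactor (a b c : ℕ) (x : ℤ) : ℚ :=
  ∏ y ∈ Finset.Icc (a : ℤ) (a + c - 1), if b + 2 * a - 1 - 2 * y ≤ x then 1 / 2 else 1

/-- A wall position on the line is a hole or a particle, and either way exactly one factor 1/2
arises. -/
theorem wallFactor_succ (hb : a + c ≤ b + 1) (hx : -(c : ℤ) ≤ x) (hxb : x < b) (hs : StrictMono s)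
    (hsite : ∀ k, IsSite a b c (x + 1) (s k)) :
    wallFactor a b c (x + 1) =
      wallFactor a b c x *
        (holeWeight a b c (x + 1) s * ∏ k, wallWeight a b (x + 1) (s k)) := by
  by_cases hw : ∃ y, x + 1 + 2 * y = b + 2 * a - 1 ∧ IsSite a b c (x + 1) y
  · obtain ⟨y, hy, hys⟩ := hw
    have h1 : holeWeight a b c (x + 1) s * ∏ k, wallWeight a b (x + 1) (s k) = 1 / 2 := by
      by_cases hk : ∃ k, s k = y
      · obtain ⟨k, rfl⟩ := hk
        rw [holeWeight, if_neg, one_mul, Finset.prod_eq_single_of_mem k (Finset.mem_univ k),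
          wallWeight, if_pos hy]
        · intro l _ hl
          have := hs.injective.ne hl
          rw [wallWeight, if_neg (by omega)]
        · rintro ⟨z, h1, -, h2⟩
          exact h2 k (by omega)
      · push Not at hk
        rw [holeWeight, if_pos ⟨y, hy, hys, hk⟩, Finset.prod_eq_one, mul_one]
        intro k _
        have := hk k
        rw [wallWeight, if_neg (by omega)]
    have hmem : y ∈ Finset.Icc (a : ℤ) (a + c - 1) := by
      unfold IsSite at hys
      rw [Finset.mem_Icc]
      omega
    rw [h1, wallFactor, wallFactor, ← Finset.mul_prod_erase _ _ hmem,
      ← Finset.mul_prod_erase _ _ hmem, if_pos (by omega), if_neg (by omega), one_mul, mul_comm]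
    congr 1
    refine Finset.prod_congr rfl fun z hz => ?_
    have := Finset.ne_of_mem_erase hz
    exact if_congr (by omega) rfl rfl
  · push Not at hw
    have h1 : holeWeight a b c (x + 1) s = 1 :=
      if_neg fun ⟨y, h1, h2, _⟩ => hw y h1 h2
    have h2 : ∏ k, wallWeight a b (x + 1) (s k) = 1 :=
      Finset.prod_eq_one fun k _ => if_neg fun h => hw _ h (hsite k)
    rw [h1, h2, mul_one, mul_one]
    refine Finset.prod_congr rfl fun y hy => ?_
    rw [Finset.mem_Icc] at hy
    have : x + 1 + 2 * y ≠ b + 2 * a - 1 := fun h => hw y h (by unfold IsSite; omega)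
    exact if_congr (by omega) rfl rfl

/-- On the leftmost line there are exactly `a` sites, so the particles fill them in order. -/
theorem eq_of_strictMono_of_isSite (hs : StrictMono s)
    (hsite : ∀ k, IsSite a b c (-(c : ℤ)) (s k)) (k : Fin a) : s k = c + (k : ℕ) := by
  have hlt (k) : (s k - c).toNat < a := by
    have := hsite k
    unfold IsSite at this
    omega
  let f : Fin a → Fin a := fun k => ⟨_, hlt k⟩
  have hf : StrictMono f := by
    intro k l hkl
    have := hs hkl
    have h1 := hsite k
    unfold IsSite at h1
    rw [Fin.lt_def]
    simp only [f]
    omega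
  have hid : f = id := (hf.range_inj strictMono_id).1
    (by rw [(Finite.surjective_of_injective hf.injective).range_eq, Set.range_id])
  have h1 := congrArg Fin.val (congrFun hid k)
  have h2 := hsite k
  unfold IsSite at h2
  simp only [f, id] at h1
  omega

theorem remaining_start (s : Fin a → ℤ) : remaining a b c (-(c : ℤ)) s = ∅ := by
  refine Finset.eq_empty_of_forall_notMem fun t ht => ?_
  cases t with
  | up x y => rw [up_mem_remaining] at ht; omega
  | down x y => rw [down_mem_remaining] at ht; omega

/-- `remaining` omits the lozenges that cross its boundary line, hence the extra `holeWeight`. The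
induction starts from an empty region and an identity matrix. -/
theorem weightedCount_remaining (ha : 0 < a) (hb : a + c ≤ b + 1) (n : ℕ) (hn : n ≤ b + c)
    (hs : StrictMono s) (hsite : ∀ k, IsSite a b c (-(c : ℤ) + n) (s k)) :
    weightedCount (remaining a b c (-(c : ℤ) + n) s) (nwCut a c ∪ neCut a b c) *
        holeWeight a b c (-(c : ℤ) + n) s =
      wallFactor a b c (-(c : ℤ) + n) * (pathMatrix a b c (-(c : ℤ) + n) s).det := by
  classical
  induction n generalizing s with
  | zero =>
    simp only [Nat.cast_zero, add_zero] at hsite ⊢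
    have h1 : pathMatrix a b c (-(c : ℤ)) s = 1 := by
      ext k j
      rw [pathMatrix, Matrix.of_apply, wallPaths, if_pos (by simp), Matrix.one_apply,
        eq_of_strictMono_of_isSite hs hsite k]
      simp [Fin.ext_iff]
    have h2 : wallFactor a b c (-(c : ℤ)) = 1 := by
      refine Finset.prod_eq_one fun y hy => if_neg ?_
      rw [Finset.mem_Icc] at hy
      omega
    have h3 : holeWeight a b c (-(c : ℤ)) s = 1 := by
      refine if_neg ?_
      rintro ⟨y, h1, h2, -⟩
      unfold IsSite at h2
      omega
    rw [remaining_start, weightedCount_empty, h1, h2, h3, Matrix.det_one]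
  | succ n ih =>
    have hx : -(c : ℤ) + (n + 1 : ℕ) = -(c : ℤ) + n + 1 := by push_cast; ring
    rw [hx] at hsite ⊢
    rw [weightedCount_remaining_succ hb (by omega) (by omega) hs hsite,
      wallFactor_succ hb (by omega) (by omega) hs hsite, mul_assoc,
      mul_assoc, det_pathMatrix_succ hb (by omega) hs hsite, Finset.mul_sum, Finset.mul_sum,
      Finset.sum_mul]
    refine Finset.sum_congr rfl fun ε hε => ?_
    have hε := (Finset.mem_filter.1 hε).2
    rw [ih (by omega) hε.strictMono]
    · ring
    · intro k
      unfold moved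
      split_ifs with hk
      · exact (hε.move k hk).1
      · exact hε.stay k hk

end weights

theorem bothWeightedCountHa_eq_det {a b c : ℕ} (ha : 0 < a) (hb : a + c ≤ b + 1) :
    bothWeightedCountHa a b c = (1 / 2) ^ c *
      (Matrix.of fun j k : Fin a => wallPaths c (b + 2 * a - 1) j b (k : ℕ)).det := by
  have hx : -(c : ℤ) + (b + c : ℕ) = b := by push_cast; ring
  have h := weightedCount_remaining (a := a) (b := b) (c := c) (s := fun k => ((k : ℕ) : ℤ)) ha hb
    (b + c) le_rfl (fun k l hkl => by simpa using hkl) (fun k => by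
      have := k.2
      unfold IsSite
      omega)
  rw [hx] at h
  -- By parity, the line `x = b` has no wall position.
  have h1 : holeWeight a b c b (fun k => ((k : ℕ) : ℤ)) = 1 := by
    refine if_neg ?_
    rintro ⟨y, h1, -⟩
    omega
  have h2 : wallFactor a b c b = (1 / 2) ^ c := by
    rw [wallFactor, Finset.prod_congr rfl fun y hy => if_pos ?_, Finset.prod_const, Int.card_Icc]
    · congr 1
      omega
    · rw [Finset.mem_Icc] at hy
      omega
  have h3 : remaining a b c b (fun k => ((k : ℕ) : ℤ)) = regionHa a b c := by
    ext t
    cases t with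
    | up x y =>
      rw [up_mem_remaining, up_mem_regionHa]
      exact and_iff_left_of_imp fun h => h.1.2
    | down x y =>
      rw [down_mem_remaining, down_mem_regionHa, and_iff_left_iff_imp]
      rintro ⟨h1, h2, -⟩
      refine ⟨h1.2, ?_⟩
      intro h
      unfold IsSite at h2
      exact ⟨⟨y.toNat, by omega⟩, by simp; omega⟩
  rw [h1, h2, h3, mul_one] at h
  rw [bothWeightedCountHa, h, ← Matrix.det_transpose]
  rfl

/-! ### The product formula -/

/-- Both sides are the product of `(s + 3j)_{a-j}` over `j < a`: on the left the term `j = 0` is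
split off, on the right the first factor of every term. -/
theorem shiftedFactorial_mul_prod (s : ℚ) (a : ℕ) :
    shiftedFactorial s a * ∏ j ∈ Finset.range a, shiftedFactorial (s + 3 * (j + 1)) (a - 1 - j) =
      (∏ j ∈ Finset.range a, (s + 3 * j)) * fallingProd a s := by
  have h := Finset.prod_range_succ' (fun j : ℕ => shiftedFactorial (s + 3 * j) (a - j)) a
  rw [Finset.prod_range_succ] at h
  have h0 (α : ℚ) : shiftedFactorial α 0 = 1 := rfl
  simp only [tsub_self, h0, mul_one, Nat.cast_zero, mul_zero, add_zero, tsub_zero] at h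
  have h1 : ∏ j ∈ Finset.range a, shiftedFactorial (s + 3 * (j + 1)) (a - 1 - j) =
      ∏ j ∈ Finset.range a, shiftedFactorial (s + 3 * (j + 1 : ℕ)) (a + 1 - 1 - (j + 1)) := by
    refine Finset.prod_congr rfl fun j _ => ?_
    rw [show a + 1 - 1 - (j + 1) = a - 1 - j by omega]
    push_cast; rfl
  rw [mul_comm, h1, fallingProd, ← Finset.prod_mul_distrib]
  refine h.symm.trans ?_
  refine Finset.prod_congr rfl fun j hj => ?_
  rw [Finset.mem_range] at hj
  rw [← shiftedFactorial_succ', show a - 1 - j + 1 = a - j by omega]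

end LozengeTiling

theorem theorem1p7 (a b c : ℕ) (ha : 0 < a) (hc : 0 < c) (hb : a + c ≤ b + 1) :
    bothWeightedCountHa a b c =
      (2 : ℚ) ^ (-(c : ℤ) - (a : ℤ)) *
        (shiftedFactorial ((b : ℚ) + 2 * c - a + 2) a / shiftedFactorial ((a : ℚ) + b - c + 2) a) *
      ∏ j ∈ Finset.Icc 1 a,
        (((j - 1)! : ℚ) * ((b + c - a + 2 * j - 1)! : ℚ) *
            shiftedFactorial ((b : ℚ) - a - c + 2 * j + 2) j *
            shiftedFactorial ((b : ℚ) + 2 * c - a + 3 * j + 2) (a - j)) /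
          (((b + 2 * j - 1)! : ℚ) * ((c + a - j)! : ℚ)) := by
  rw [bothWeightedCountHa_eq_det ha hb, det_wallPaths hc hb]
  obtain ⟨δ, hδ⟩ : ∃ δ, b + 1 = a + c + δ := ⟨b + 1 - (a + c), by omega⟩
  have hbq : (b : ℚ) = a + c + δ - 1 := by
    have : (b : ℚ) + 1 = a + c + δ := by exact_mod_cast hδ
    linarith
  have e1 : (b : ℚ) + 2 * c - a + 2 = δ + 3 * c + 1 := by rw [hbq]; ring
  have e2 : (a : ℚ) + b - c + 2 = δ + 2 * a + 1 := by rw [hbq]; ring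
  have hprod := Finset.prod_Ico_eq_prod_range (fun j : ℕ =>
        (((j - 1)! : ℚ) * ((b + c - a + 2 * j - 1)! : ℚ) *
            shiftedFactorial ((b : ℚ) - a - c + 2 * j + 2) j *
            shiftedFactorial ((b : ℚ) + 2 * c - a + 3 * j + 2) (a - j)) /
          (((b + 2 * j - 1)! : ℚ) * ((c + a - j)! : ℚ))) 1 (a + 1)
  rw [show Finset.Icc 1 a = Finset.Ico 1 (a + 1) from rfl, hprod, add_tsub_cancel_right,
    Finset.prod_div_distrib, Finset.prod_mul_distrib, Finset.prod_mul_distrib,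
    Finset.prod_mul_distrib, Finset.prod_mul_distrib, Finset.prod_mul_distrib]
  have f1 : ∏ j ∈ Finset.range a, ((1 + j - 1)! : ℚ) = factorialProd 1 a 0 :=
    Finset.prod_congr rfl fun j _ => by congr 2; omega
  have f2 : ∏ j ∈ Finset.range a, ((b + c - a + 2 * (1 + j) - 1)! : ℚ) =
      factorialProd 2 a (δ + 2 * c) :=
    Finset.prod_congr rfl fun j _ => by congr 2; omega
  have f3 : ∏ j ∈ Finset.range a, ((b + 2 * (1 + j) - 1)! : ℚ) = factorialProd 2 a (δ + a + c) :=
    Finset.prod_congr rfl fun j _ => by congr 2; omega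
  have f4 : ∏ j ∈ Finset.range a, ((c + a - (1 + j))! : ℚ) = factorialProd 1 a c := by
    rw [factorialProd, ← Finset.prod_range_reflect]
    refine Finset.prod_congr rfl fun j hj => ?_
    rw [Finset.mem_range] at hj
    congr 2; omega
  -- The range is `1 ≤ l ≤ a` instead of `l < a`: the term `l = 0` is empty, and the surplus term `l
  -- = a` cancels the denominator `(a + b - c + 2)_a`.
  have f5 : ∏ j ∈ Finset.range a,
      shiftedFactorial ((b : ℚ) - a - c + 2 * (1 + j : ℕ) + 2) (1 + j) =
        risingProd a δ * shiftedFactorial (δ + 2 * a + 1) a := by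
    rw [← risingProd_succ, risingProd, Finset.prod_range_succ']
    simp only [CharP.cast_eq_zero, mul_zero, add_zero]
    rw [show shiftedFactorial ((δ : ℚ) + 1) 0 = 1 from rfl, mul_one]
    refine Finset.prod_congr rfl fun j _ => ?_
    rw [add_comm 1 j]
    congr 1
    rw [hbq]; push_cast; ring
  have f6 : ∏ j ∈ Finset.range a,
      shiftedFactorial ((b : ℚ) + 2 * c - a + 3 * (1 + j : ℕ) + 2) (a - (1 + j)) =
        ∏ j ∈ Finset.range a, shiftedFactorial ((δ : ℚ) + 3 * c + 1 + 3 * (j + 1)) (a - 1 - j) := by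
    refine Finset.prod_congr rfl fun j _ => ?_
    rw [Nat.sub_add_eq]
    congr 1
    rw [hbq]; push_cast; ring
  have f7 := shiftedFactorial_mul_prod ((δ : ℚ) + 3 * c + 1) a
  have hpow : (2 : ℚ) ^ (-(c : ℤ) - (a : ℤ)) = (1 / 2) ^ c * (1 / 2) ^ a := by
    rw [sub_eq_add_neg, zpow_add₀ two_ne_zero, zpow_neg, zpow_neg, zpow_natCast, zpow_natCast]
    simp
  have hpos := shiftedFactorial_pos (α := (δ : ℚ) + 2 * a + 1) (by positivity) a
  have hd : b + 1 - a - c = δ := by omega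
  rw [f1, f2, f3, f4, f5, f6, e1, e2, hpow, Finset.prod_const,
    Finset.card_range, hd, catalanValue]
  have h2 := factorialProd_pos 2 a (δ + a + c)
  have h1 := factorialProd_pos 1 a c
  field_simp
  linear_combination (-(factorialProd 1 a 0 * factorialProd 2 a (δ + 2 * c) * risingProd a δ)) * f7
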